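/- Consider a linear time-invariant system with realization $(C,A,B,D)$, $A\in\mathbb{R}^{n\times n}$, $B\in\mathbb{R}^{n\times m}$, $C\in\mathbb{R}^{p\times n}$, $D\in\mathbb{R}^{p\times m}$, that is strictly stable, $\rho(A)<1$. For $i=1,\dots,N$ let $$x_{i,0}=0,\qquad x_{i,t+1}=Ax_{i,t}+Bu_{i,t}+w^{(1)}_{i,t},\qquad y_{i,t}=Cx_{i,t}+Du_{i,t}+w^{(2)}_{i,t}\qquad(t\ge 0),$$ where all the vectors $u_{i,t}, w^{(1)}_{i,t}, w^{(2)}_{i,t}$ are mutually independent, $u_{i,t}\sim\mathcal N(0,\sigma_u^2 I_m)$ with $\sigma_u>0$, and $w^{(1)}_{i,t}$, $w^{(2)}_{i,t}$ are zero-mean subgaussian random vectors with variance proxies $\sigma_{w^{(1)}}^2$ and $\sigma_{w^{(2)}}^2$; put $\sigma_w=\max(\sigma_{w^{(1)}},\sigma_{w^{(2)}})$. Define $$\Gamma_\infty=\sum_{t=0}^\infty \sigma_u^2A^tB(A^tB)'+\sigma_w^2A^t(A^t)',\qquad \Gamma^O_\infty=I_p+\sum_{t=0}^\infty CA^t(CA^t)'.$$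 Let $1\le L\le\bar T$, $T_f=\bar T-L+1$, and let $G^{(L)}=[D\;\; CB\;\; CAB\;\cdots\; CA^{L-1}B]$ be the matrix of the first $L+1$ Markov parameters. Let $\mathbf Y$ be the $p\times NT_f$ matrix with columns $y_{i,t}$, and $\mathbf U$ the $m(L+1)\times NT_f$ matrix with columns $(u_{i,t}',u_{i,t-1}',\dots,u_{i,t-L}')'$, for $i=1,\dots,N$ and $t=L,\dots,\bar T$, and let $\hat G^{(L)}=\mathbf Y\mathbf U^\dagger$ be the pooled least-squares estimate, where $\dagger$ is the Moore–Penrose pseudoinverse. Write $\|\cdot\|$ for the spectral norm. There is a universal constant $c>0$ (independent of the system, of the distributions and of all parameters) such that the following holds for every $\delta\in(0,1/e)$ whenever $$NT_f\ \ge\ c\,L\bigl(mL+\ln(L/\delta)\bigr).$$ (i) For every $\varepsilon>0$, if $$NT_f\ \ge\ c\,\frac{L}{\varepsilon^2\sigma_u^2}\Bigl(p+(m+n)L+\ln\frac{N\bar T}{\delta}\Bigr)^2\Bigl(\|CA^L\|^2\|\Gamma_\infty\|+\sigma_w^2\|\Gamma^O_\infty\|\Bigr),$$ then $\Pr\bigl(\|\hat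 G^{(L)}-G^{(L)}\|\le\varepsilon\bigr)\ge 1-\delta$. (ii) With probability at least $1-\delta$, $$\|\hat G^{(L)}-G^{(L)}\|\ \le\ c\,\frac{\sqrt L\,\bigl(p+(m+n)L+\ln(N\bar T/\delta)\bigr)}{\sigma_u\sqrt{NT_f}}\Bigl(\|CA^L\|\,\|\Gamma_\infty\|^{1/2}+\sigma_w\|\Gamma^O_\infty\|^{1/2}\Bigr).$$ -/

import Mathlib

open MeasureTheory ProbabilityTheory Matrix
open scoped NNReal

/-! ### Moore–Penrose pseudoinverse of a real matrix -/

/-- The four Penrose conditions: `X` is the Moore–Penrose pseudoinverse of `M`. -/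
structure IsMoorePenrose {a b : Type*} [Fintype a] [Fintype b]
    (M : Matrix a b ℝ) (X : Matrix b a ℝ) : Prop where
  mul_mul_self : M * X * M = M
  self_mul_mul : X * M * X = X
  isSymm_left : (M * X)ᵀ = M * X
  isSymm_right : (X * M)ᵀ = X * M

theorem IsMoorePenrose.unique {a b : Type*} [Fintype a] [Fintype b]
    {M : Matrix a b ℝ} {X Y : Matrix b a ℝ}
    (hX : IsMoorePenrose M X) (hY : IsMoorePenrose M Y) : X = Y := by
  have h1 : M * X = M * Y := by
    calc M * X = (M * X)ᵀ := hX.isSymm_left.symm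
      _ = (M * Y * (M * X))ᵀ := by rw [← Matrix.mul_assoc, hY.mul_mul_self]
      _ = (M * X)ᵀ * (M * Y)ᵀ := Matrix.transpose_mul _ _
      _ = M * X * (M * Y) := by rw [hX.isSymm_left, hY.isSymm_left]
      _ = M * Y := by rw [← Matrix.mul_assoc, hX.mul_mul_self]
  have h2 : X * M = Y * M := by
    calc X * M = (X * M)ᵀ := hX.isSymm_right.symm
      _ = (X * M * (Y * M))ᵀ := by
        rw [Matrix.mul_assoc X M, ← Matrix.mul_assoc M Y M, hY.mul_mul_self]
      _ = (Y * M)ᵀ * (X * M)ᵀ := Matrix.transpose_mul _ _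
      _ = Y * M * (X * M) := by rw [hX.isSymm_right, hY.isSymm_right]
      _ = Y * M := by rw [Matrix.mul_assoc Y M, ← Matrix.mul_assoc M X M, hX.mul_mul_self]
  calc X = X * M * X := hX.self_mul_mul.symm
    _ = Y * (M * X) := by rw [h2, Matrix.mul_assoc]
    _ = Y := by rw [h1, ← Matrix.mul_assoc, hY.self_mul_mul]

theorem exists_isMoorePenrose {a b : Type*} [Fintype a] [Fintype b]
    (M : Matrix a b ℝ) : ∃ X, IsMoorePenrose M X := by
  classical
  have hH : (M * Mᵀ).IsHermitian := by
    simpa using Matrix.isHermitian_mul_conjTranspose_self M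
  obtain ⟨V, d, hV, hM⟩ : ∃ (V : Matrix a a ℝ) (d : a → ℝ),
      Vᵀ * V = 1 ∧ M * Mᵀ = V * diagonal d * Vᵀ := by
    refine ⟨hH.eigenvectorUnitary, hH.eigenvalues, ?_, ?_⟩
    · exact (Matrix.mem_unitaryGroup_iff'.1 hH.eigenvectorUnitary.2)
    · conv_lhs => rw [hH.spectral_theorem]
      rfl
  have key : ∀ e f : a → ℝ, (V * diagonal e * Vᵀ) * (V * diagonal f * Vᵀ)
      = V * diagonal (fun i => e i * f i) * Vᵀ := by
    intro e f
    calc (V * diagonal e * Vᵀ) * (V * diagonal f * Vᵀ)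
        = V * diagonal e * (Vᵀ * V) * diagonal f * Vᵀ := by simp only [Matrix.mul_assoc]
      _ = _ := by rw [hV, Matrix.mul_one, Matrix.mul_assoc V, diagonal_mul_diagonal]
  have symm : ∀ e : a → ℝ, (V * diagonal e * Vᵀ)ᵀ = V * diagonal e * Vᵀ := by
    intro e
    simp [Matrix.transpose_mul, Matrix.mul_assoc]
  set H := M * Mᵀ with hHdef
  set P := V * diagonal (fun i => (d i)⁻¹) * Vᵀ with hP
  have hPs : Pᵀ = P := symm _
  have hHPs : (H * P)ᵀ = H * P := by rw [hM, hP, key]; exact symm _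
  have hHPH : H * P * H = H := by
    rw [hM, hP, key, key]; congr 3; funext i
    exact mul_inv_mul_cancel (d i)
  have hPHP : P * H * P = P := by
    rw [hM, hP, key, key]; congr 3; funext i
    simpa using mul_inv_mul_cancel (d i)⁻¹
  have hz : H * P * M = M := by
    have h0 : (H * P * M - M) * (H * P * M - M)ᴴ = 0 := by
      have e1 : (H * P * M - M) * Mᵀ = 0 := by
        rw [Matrix.sub_mul, Matrix.mul_assoc (H * P), ← hHdef, hHPH, sub_self]
      rw [Matrix.conjTranspose_eq_transpose_of_trivial, Matrix.transpose_sub,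
        Matrix.transpose_mul, Matrix.mul_sub, ← Matrix.mul_assoc, e1]
      simp
    exact sub_eq_zero.1 (Matrix.self_mul_conjTranspose_eq_zero.1 h0)
  refine ⟨Mᵀ * P, ?_, ?_, ?_, ?_⟩
  · rw [← Matrix.mul_assoc, ← hHdef, hz]
  · calc Mᵀ * P * M * (Mᵀ * P) = Mᵀ * (P * (M * Mᵀ) * P) := by simp only [Matrix.mul_assoc]
      _ = Mᵀ * P := by rw [← hHdef, hPHP]
  · rw [← Matrix.mul_assoc, ← hHdef, hHPs]
  · rw [Matrix.transpose_mul, Matrix.transpose_mul, hPs, Matrix.transpose_transpose,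
      ← Matrix.mul_assoc]

/-- The Moore–Penrose pseudoinverse `M†` of a real matrix. -/
noncomputable def pinv {a b : Type*} [Fintype a] [Fintype b]
    (M : Matrix a b ℝ) : Matrix b a ℝ :=
  (exists_isMoorePenrose M).choose

theorem isMoorePenrose_pinv {a b : Type*} [Fintype a] [Fintype b]
    (M : Matrix a b ℝ) : IsMoorePenrose M (pinv M) :=
  (exists_isMoorePenrose M).choose_spec

/-- The spectral norm of a matrix: its operator norm between Euclidean spaces. -/
noncomputable def specNorm {a b : Type*} [Fintype a] [Fintype b] [DecidableEq b]
    (M : Matrix a b ℝ) : ℝ :=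
  ‖(Matrix.toEuclideanLin M).toContinuousLinearMap‖

/-! ### Linear time-invariant systems -/

/-- A realization `(C, A, B, D)` with state, input and output dimensions `n`, `m`, `p`. -/
structure LTI (n m p : ℕ) where
  C : Matrix (Fin p) (Fin n) ℝ
  A : Matrix (Fin n) (Fin n) ℝ
  B : Matrix (Fin n) (Fin m) ℝ
  D : Matrix (Fin p) (Fin m) ℝ

namespace LTI

variable {n m p : ℕ}

/-- Strict stability: the spectral radius of `A` (over `ℂ`) is less than one. -/
def StrictlyStable (M : LTI n m p) : Prop :=
  spectralRadius ℂ (M.A.map (algebraMap ℝ ℂ)) < 1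

/-- The state trajectory: `x 0 = 0` and `x (t+1) = A x t + B u t + w₁ t`. -/
def state (M : LTI n m p) (u : ℕ → Fin m → ℝ) (w₁ : ℕ → Fin n → ℝ) : ℕ → Fin n → ℝ
  | 0 => 0
  | t + 1 => M.A *ᵥ M.state u w₁ t + M.B *ᵥ u t + w₁ t

/-- The output: `y t = C x t + D u t + w₂ t`. -/
def output (M : LTI n m p) (u : ℕ → Fin m → ℝ) (w₁ : ℕ → Fin n → ℝ) (w₂ : ℕ → Fin p → ℝ)
    (t : ℕ) : Fin p → ℝ :=
  M.C *ᵥ M.state u w₁ t + M.D *ᵥ u t + w₂ t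

/-- The Markov parameters: `G₀ = D` and `Gₖ = C A^(k-1) B` for `k ≥ 1`. -/
def markov (M : LTI n m p) : ℕ → Matrix (Fin p) (Fin m) ℝ
  | 0 => M.D
  | k + 1 => M.C * M.A ^ k * M.B

/-- `G^(L) = [D, CB, CAB, …, C A^(L-1) B]`; the columns are indexed by a block index in
`{0, …, L}` and a coordinate of the input. -/
def markovMatrix (M : LTI n m p) (L : ℕ) : Matrix (Fin p) (Fin (L + 1) × Fin m) ℝ :=
  Matrix.of fun a k => M.markov k.1 a k.2

/-- `Γ_∞ = ∑ₜ σᵤ² (Aᵗ B)(Aᵗ B)' + σ_w² Aᵗ (Aᵗ)'`. -/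
noncomputable def gramian (M : LTI n m p) (σu σw : ℝ) : Matrix (Fin n) (Fin n) ℝ :=
  ∑' t : ℕ, (σu ^ 2 • ((M.A ^ t * M.B) * (M.A ^ t * M.B)ᵀ)
    + σw ^ 2 • (M.A ^ t * (M.A ^ t)ᵀ))

/-- `Γ^O_∞ = I + ∑ₜ (C Aᵗ)(C Aᵗ)'`. -/
noncomputable def obsGramian (M : LTI n m p) : Matrix (Fin p) (Fin p) ℝ :=
  1 + ∑' t : ℕ, (M.C * M.A ^ t) * (M.C * M.A ^ t)ᵀ

end LTI

/-! ### Pooled least squares -/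

/-- The pooled input matrix `𝐔 = [U₁ ⋯ U_N]`. The column with index `(i, s)` is the stacked vector
of `u_{i,t}, u_{i,t-1}, …, u_{i,t-L}` at time `t = L + s`, where `s = 0, …, T̄ - L`. -/
def inputMatrix {N m : ℕ} (L Tbar : ℕ) (u : Fin N → ℕ → Fin m → ℝ) :
    Matrix (Fin (L + 1) × Fin m) (Fin N × Fin (Tbar - L + 1)) ℝ :=
  Matrix.of fun j c => u c.1 (L + c.2 - j.1) j.2

/-- The pooled output matrix `𝐘 = [Y₁ ⋯ Y_N]`. The column with index `(i, s)` is `y_{i,L+s}`. -/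
def outputMatrix {N p : ℕ} (L Tbar : ℕ) (y : Fin N → ℕ → Fin p → ℝ) :
    Matrix (Fin p) (Fin N × Fin (Tbar - L + 1)) ℝ :=
  Matrix.of fun a c => y c.1 (L + c.2) a

/-- The least-squares estimate `Ĝ^(L) = 𝐘 𝐔†`. -/
noncomputable def lsEstimate {N m p : ℕ} (L Tbar : ℕ) (u : Fin N → ℕ → Fin m → ℝ)
    (y : Fin N → ℕ → Fin p → ℝ) : Matrix (Fin p) (Fin (L + 1) × Fin m) ℝ :=
  outputMatrix L Tbar y * pinv (inputMatrix L Tbar u)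

/-- The spectral-norm error `‖Ĝ^(L) - G^(L)‖` of the pooled least-squares estimate from the
trajectories of `M` driven by the inputs `u i`, process noise `w₁ i` and measurement noise
`w₂ i`. -/
noncomputable def lsError {N n m p : ℕ} (M : LTI n m p) (L Tbar : ℕ) (u : Fin N → ℕ → Fin m → ℝ)
    (w₁ : Fin N → ℕ → Fin n → ℝ) (w₂ : Fin N → ℕ → Fin p → ℝ) : ℝ :=
  specNorm (lsEstimate L Tbar u (fun i => M.output (u i) (w₁ i) (w₂ i)) - M.markovMatrix L)

/-! ### The statistical model -/

/-- A random vector is subgaussian with variance proxy `v`: every one-dimensional marginal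
`⟨z, w⟩` along a unit vector `z` satisfies `𝔼 exp (s ⟨z, w⟩) ≤ exp (v s² / 2)` for all `s`. -/
def IsSubgaussianVector {Ω : Type*} [MeasurableSpace Ω] {d : ℕ} (w : Ω → Fin d → ℝ) (v : ℝ≥0)
    (μ : Measure Ω) : Prop :=
  ∀ z : Fin d → ℝ, z ⬝ᵥ z = 1 → HasSubgaussianMGF (fun ω => z ⬝ᵥ w ω) v μ

/-- The distributional assumptions on the inputs `u i t`, the process noise `w₁ i t` and the
measurement noise `w₂ i t` of `N` trajectories: all these random vectors are jointly independent,
the inputs have law `𝒩(0, σᵤ² I)`, and the noises are subgaussian (hence centred) with variance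
proxies `σ₁²` and `σ₂²`. -/
structure TrajectoryModel {Ω : Type*} [MeasurableSpace Ω] (μ : Measure Ω) {N n m p : ℕ}
    (u : Fin N → ℕ → Ω → Fin m → ℝ) (w₁ : Fin N → ℕ → Ω → Fin n → ℝ)
    (w₂ : Fin N → ℕ → Ω → Fin p → ℝ) (σu σ₁ σ₂ : ℝ≥0) : Prop where
  measurable_input : ∀ i t, Measurable (u i t)
  measurable_process : ∀ i t, Measurable (w₁ i t)
  measurable_measurement : ∀ i t, Measurable (w₂ i t)
  input_law : ∀ i t, μ.map (u i t) = Measure.pi (fun _ : Fin m => gaussianReal 0 (σu ^ 2))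
  process_subgaussian : ∀ i t, IsSubgaussianVector (w₁ i t) (σ₁ ^ 2) μ
  measurement_subgaussian : ∀ i t, IsSubgaussianVector (w₂ i t) (σ₂ ^ 2) μ
  indep : iIndep (fun k : (Fin N × ℕ) ⊕ (Fin N × ℕ) ⊕ (Fin N × ℕ) =>
    Sum.elim (fun a => MeasurableSpace.comap (u a.1 a.2) inferInstance)
      (Sum.elim (fun a => MeasurableSpace.comap (w₁ a.1 a.2) inferInstance)
        (fun a => MeasurableSpace.comap (w₂ a.1 a.2) inferInstance)) k) μ

/-! Write `𝐘 = G 𝐔 + E`, where the columns of `E` collect the inputs older than `L` steps and all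
the noise. Once `𝐔` has full row rank, `Ĝ - G = E 𝐔†`, and `‖E 𝐔†‖ ≤ ‖E 𝐔ᵀ‖ / κ²` if `κ` bounds the
singular values of `𝐔` from below (`specNorm_mul_pinv_le`). On `1/16`-nets of the unit spheres both
quantities reduce to scalar sums over the columns: `∑ z²` for the conditioning and `∑ e z` for the
cross term. Here `z` is the marginal of a stacked input, with law `𝒩(0, σᵤ²)`, and `e` is a marginal
of the residual, subgaussian with proxy `V = ‖CA^L‖²‖Γ_∞‖ + σ_w²‖Γ^O_∞‖`
(`hasSubgaussianMGF_residual`).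

The columns are dependent: windows overlap, and residuals contain inputs of earlier windows.
Colouring columns by their time modulo `L + 1` makes the windows of one colour and one trajectory
disjoint. Within a class each `z` is then independent of its own `e` and of all earlier pairs
(`coloredAdapted`), so exponential moments are integrated out one factor at a time. Hölder's
inequality recombines the `L + 1` classes and divides exponents by `L + 1`.

For `∑ e z` the exponent is compensated by a multiple of `∑ e²`, which brings its exponential moment
down to at most one. The compensator is paid for by Jensen's inequality, with no independence among
the `e` (`measure_sum_mul_ge_le`). The resulting tail `2 exp (-s)` at a level linear in `s` explains
the unsquare-rooted `p + (m+n)L + ln` in the rate. A union bound over the nets and a choice of `s`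
finish the proof. -/

/-! ### Nets of Euclidean spheres -/

section Nets

variable {E : Type*} [NormedAddCommGroup E] [InnerProductSpace ℝ E]

/-- Volume comparison: the balls of radius `ε / 2` about the points are disjoint and lie in the ball
of radius `1 + ε / 2`. -/
theorem card_le_of_separated_unit [FiniteDimensional ℝ E] (s : Finset E) {ε : ℝ} (hε : 0 < ε)
    (hs : ∀ x ∈ s, ‖x‖ = 1) (hsep : ∀ x ∈ s, ∀ y ∈ s, x ≠ y → ε ≤ ‖x - y‖) :
    (s.card : ℝ) ≤ (1 + 2 / ε) ^ Module.finrank ℝ E := by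
  borelize E
  let μ : Measure E := Measure.addHaar
  have hdisj : (s : Set E).Pairwise (Function.onFun Disjoint fun x => Metric.ball x (ε / 2)) := by
    intro x hx y hy hxy
    apply Metric.ball_disjoint_ball
    rw [dist_eq_norm]
    linarith [hsep x hx y hy hxy]
  have hsub : (⋃ x ∈ s, Metric.ball x (ε / 2)) ⊆ Metric.ball (0 : E) (1 + ε / 2) := by
    refine Set.iUnion₂_subset fun x hx => Metric.ball_subset_ball' ?_
    rw [dist_zero_right, hs x hx]
    linarith
  have hvol : (s.card : ENNReal) * ENNReal.ofReal ((ε / 2) ^ Module.finrank ℝ E) * μ (Metric.ball 0 1)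
      ≤ ENNReal.ofReal ((1 + ε / 2) ^ Module.finrank ℝ E) * μ (Metric.ball 0 1) := by
    calc _ = μ (⋃ x ∈ s, Metric.ball x (ε / 2)) := by
          rw [measure_biUnion_finset hdisj fun _ _ => measurableSet_ball]
          simp only [Measure.addHaar_ball_of_pos μ _ (half_pos hε), Finset.sum_const, nsmul_eq_mul]
          ring
      _ ≤ μ (Metric.ball (0 : E) (1 + ε / 2)) := measure_mono hsub
      _ = _ := Measure.addHaar_ball_of_pos μ _ (by positivity)
  have h0 : μ (Metric.ball 0 1) ≠ 0 := (Metric.measure_ball_pos μ _ one_pos).ne'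
  have h1 := (ENNReal.mul_le_mul_iff_left h0 measure_ball_lt_top.ne).1 hvol
  rw [← ENNReal.ofReal_natCast, ← ENNReal.ofReal_mul (by positivity),
    ENNReal.ofReal_le_ofReal_iff (by positivity)] at h1
  have h2 : (1 + 2 / ε) ^ Module.finrank ℝ E * (ε / 2) ^ Module.finrank ℝ E
      = (1 + ε / 2) ^ Module.finrank ℝ E := by
    rw [← mul_pow]
    congr 1
    field_simp
    ring
  rw [← h2] at h1
  exact le_of_mul_le_mul_right h1 (by positivity)

/-- A separated set of maximal cardinality is a net, since a point far from it could be added. The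
volume bound makes the maximum exist. -/
theorem exists_unit_net (E : Type*) [NormedAddCommGroup E] [InnerProductSpace ℝ E]
    [FiniteDimensional ℝ E] {ε : ℝ} (hε : 0 < ε) :
    ∃ s : Finset E, (∀ x ∈ s, ‖x‖ = 1) ∧ (∀ x : E, ‖x‖ = 1 → ∃ y ∈ s, ‖x - y‖ ≤ ε) ∧
      (s.card : ℝ) ≤ (1 + 2 / ε) ^ Module.finrank ℝ E := by
  classical
  let P : ℕ → Prop := fun k => ∃ s : Finset E, (∀ x ∈ s, ‖x‖ = 1) ∧
    (∀ x ∈ s, ∀ y ∈ s, x ≠ y → ε ≤ ‖x - y‖) ∧ s.card = k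
  have hbd : ∀ k, P k → k ≤ ⌊(1 + 2 / ε) ^ Module.finrank ℝ E⌋₊ := by
    rintro k ⟨s, h1, h2, rfl⟩
    exact Nat.le_floor (card_le_of_separated_unit s hε h1 h2)
  have hP0 : P 0 := ⟨∅, by simp, by simp, rfl⟩
  obtain ⟨s, h1, h2, h3⟩ := Nat.findGreatest_spec (P := P) (Nat.zero_le _) hP0
  refine ⟨s, h1, fun x hx => ?_, card_le_of_separated_unit s hε h1 h2⟩
  by_contra! hcon
  have hxs : x ∉ s := fun h => by
    have := hcon x h
    simp at this
    linarith
  have hP : P (s.card + 1) := by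
    refine ⟨insert x s, ?_, ?_, Finset.card_insert_of_notMem hxs⟩
    · intro y hy
      rcases Finset.mem_insert.1 hy with rfl | hy
      exacts [hx, h1 y hy]
    · intro y hy z hz hyz
      rcases Finset.mem_insert.1 hy with rfl | hy <;> rcases Finset.mem_insert.1 hz with rfl | hz
      · exact absurd rfl hyz
      · exact (hcon z hz).le
      · rw [norm_sub_rev]; exact (hcon y ‹_›).le
      · exact h2 y hy z hz hyz
  have h4 := Nat.le_findGreatest (hbd _ hP) hP
  rw [← h3] at h4
  exact absurd h4 (by simp)

variable {F : Type*} [NormedAddCommGroup F] [NormedSpace ℝ F]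

/-- A linear map that is bounded by `R` on an `ε`-net of the unit sphere has norm at most
`R / (1 - ε)`. -/
theorem opNorm_le_of_net {s : Set E} {ε R : ℝ} (hε : ε < 1) (hR : 0 ≤ R)
    (hs : ∀ x : E, ‖x‖ = 1 → ∃ y ∈ s, ‖x - y‖ ≤ ε) (T : E →L[ℝ] F)
    (hT : ∀ y ∈ s, ‖T y‖ ≤ R) : ‖T‖ ≤ R / (1 - ε) := by
  have key : ‖T‖ ≤ R + ‖T‖ * ε := by
    -- The sign of `ε` is not assumed; it follows from the net property as soon as a unit vector
    -- exists. Otherwise the space is trivial.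
    have hε0 : 0 ≤ R + ‖T‖ * ε ∨ ∀ x : E, ‖x‖ ≠ 1 := by
      by_cases h : ∃ x : E, ‖x‖ = 1
      · obtain ⟨x, hx⟩ := h
        obtain ⟨y, -, hy⟩ := hs x hx
        have := (norm_nonneg _).trans hy
        left; positivity
      · right; push Not at h; exact h
    rcases hε0 with h0 | h0
    · refine T.opNorm_le_of_unit_norm h0 fun x hx => ?_
      obtain ⟨y, hy, hxy⟩ := hs x hx
      calc ‖T x‖ = ‖T y + T (x - y)‖ := by rw [← map_add]; congr 2; abel
        _ ≤ ‖T y‖ + ‖T (x - y)‖ := norm_add_le _ _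
        _ ≤ R + ‖T‖ * ε := add_le_add (hT y hy) ((T.le_opNorm _).trans (by gcongr))
    · have : T = 0 := by
        ext x
        by_cases hx : x = 0
        · simp [hx]
        · exact absurd (norm_smul_inv_norm (𝕜 := ℝ) hx) (h0 _)
      simp [this, hR]
  rw [le_div_iff₀ (by linarith)]
  linarith

/-- A lower bound on an `ε`-net of the unit sphere extends to the whole space. -/
theorem le_norm_of_net {s : Set E} {ε R r : ℝ} (hε : ε < 1) (hR : 0 ≤ R)
    (hs : ∀ x : E, ‖x‖ = 1 → ∃ y ∈ s, ‖x - y‖ ≤ ε) (T : E →L[ℝ] F)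
    (hT : ∀ y ∈ s, ‖T y‖ ≤ R) (hr : ∀ y ∈ s, r ≤ ‖T y‖) (x : E) :
    (r - R / (1 - ε) * ε) * ‖x‖ ≤ ‖T x‖ := by
  by_cases hx : x = 0
  · simp [hx]
  have hn : 0 < ‖x‖ := norm_pos_iff.2 hx
  have hu : ‖(‖x‖⁻¹ • x)‖ = 1 := norm_smul_inv_norm (𝕜 := ℝ) hx
  obtain ⟨y, hy, hxy⟩ := hs _ hu
  have h1 : ‖T y‖ ≤ ‖T (‖x‖⁻¹ • x)‖ + ‖T (‖x‖⁻¹ • x - y)‖ := by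
    calc ‖T y‖ = ‖T (‖x‖⁻¹ • x) - T (‖x‖⁻¹ • x - y)‖ := by rw [← map_sub]; congr 2; abel
      _ ≤ _ := norm_sub_le _ _
  have h2 : ‖T (‖x‖⁻¹ • x - y)‖ ≤ R / (1 - ε) * ε :=
    (T.le_opNorm _).trans (mul_le_mul (opNorm_le_of_net hε hR hs T hT) hxy (norm_nonneg _)
      (div_nonneg hR (by linarith)))
  have h3 : ‖T (‖x‖⁻¹ • x)‖ = ‖x‖⁻¹ * ‖T x‖ := by
    rw [map_smul, norm_smul, norm_inv, norm_norm]
  have h4 := hr y hy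
  have h5 : r - R / (1 - ε) * ε ≤ ‖x‖⁻¹ * ‖T x‖ := by linarith
  calc (r - R / (1 - ε) * ε) * ‖x‖ ≤ ‖x‖⁻¹ * ‖T x‖ * ‖x‖ := by gcongr
    _ = ‖T x‖ := by field_simp

/-- Test against a net point close to `v / ‖v‖`. Only upper bounds on the inner products enter, so
one-sided tail estimates suffice later. -/
theorem norm_le_of_net {s : Set E} {ε R : ℝ} (hε : ε < 1) (hR : 0 ≤ R)
    (hs : ∀ x : E, ‖x‖ = 1 → ∃ y ∈ s, ‖x - y‖ ≤ ε) (v : E)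
    (hv : ∀ y ∈ s, inner ℝ y v ≤ R) : ‖v‖ ≤ R / (1 - ε) := by
  by_cases h : v = 0
  · rw [h, norm_zero]; exact div_nonneg hR (by linarith)
  have hn : 0 < ‖v‖ := norm_pos_iff.2 h
  obtain ⟨y, hy, hxy⟩ := hs _ (norm_smul_inv_norm (𝕜 := ℝ) h)
  have h1 : inner ℝ (‖v‖⁻¹ • v) v = ‖v‖ := by
    rw [real_inner_smul_left, real_inner_self_eq_norm_sq]; field_simp
  have h2 : inner ℝ (‖v‖⁻¹ • v - y) v ≤ ε * ‖v‖ :=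
    (real_inner_le_norm _ _).trans (by gcongr; exact hxy)
  rw [inner_sub_left, h1] at h2
  rw [le_div_iff₀ (by linarith)]
  linarith [hv y hy]

end Nets

/-! ### Exponential moments along adapted sequences -/

section Adapted

open scoped ENNReal

variable {Ω ι : Type*} [mΩ : MeasurableSpace Ω] {μ : Measure Ω} [IsProbabilityMeasure μ]
  {γ : Measure ℝ} [IsProbabilityMeasure γ] {F : ℝ → ℝ → ℝ≥0∞} {K : ℝ≥0∞} {e z : ι → Ω → ℝ}

/-- If `z i` has law `γ` and is independent of `e i` and of all earlier pairs `(e j, z j)`, then the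
expectation of `∏ F (e i) (z i)` is controlled by the worst conditional expectation of a factor. -/
theorem lintegral_prod_adapted_le (hF : Measurable (Function.uncurry F))
    (hK : ∀ x, ∫⁻ y, F x y ∂γ ≤ K) (hzm : ∀ i, Measurable (z i)) (τ : ι → ℕ)
    (𝓕 : ι → MeasurableSpace Ω) (hle : ∀ i, 𝓕 i ≤ mΩ) (hz : ∀ i, μ.map (z i) = γ)
    (hind : ∀ i, Indep (𝓕 i) (MeasurableSpace.comap (z i) inferInstance) μ)
    (he : ∀ i, Measurable[𝓕 i] (e i)) (s : Finset ι)
    (hpast : ∀ i ∈ s, ∀ j ∈ s, j ≠ i → τ j ≤ τ i →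
      Measurable[𝓕 i] (e j) ∧ Measurable[𝓕 i] (z j)) :
    ∫⁻ ω, ∏ i ∈ s, F (e i ω) (z i ω) ∂μ ≤ K ^ s.card := by
  classical
  -- Peel off the latest index `a`: all other pairs are `𝓕 a`-measurable, so `z a` integrates out
  -- with the rest frozen.
  induction s using Finset.induction_on_max_value τ with
  | empty => simp
  | insert a s has hmax ih =>
    have ih' := ih fun i hi j hj => hpast i (Finset.mem_insert_of_mem hi) j
      (Finset.mem_insert_of_mem hj)
    let Y : Ω → ℝ≥0∞ × ℝ := fun ω => (∏ i ∈ s, F (e i ω) (z i ω), e a ω)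
    have hY : Measurable[𝓕 a] Y := by
      refine Measurable.prodMk (Finset.measurable_fun_prod s fun i hi => ?_) (he a)
      have h := hpast a (Finset.mem_insert_self _ _) i (Finset.mem_insert_of_mem hi)
        (fun h => has (h ▸ hi)) (hmax i hi)
      exact hF.comp (h.1.prodMk h.2)
    have hYm : Measurable Y := hY.mono (hle a) le_rfl
    have hindY : IndepFun Y (z a) μ :=
      indep_of_indep_of_le_left (hind a) hY.comap_le
    have hmap := (indepFun_iff_map_prod_eq_prod_map_map hYm.aemeasurable
      (hzm a).aemeasurable).1 hindY
    have hG : Measurable fun p : (ℝ≥0∞ × ℝ) × ℝ => p.1.1 * F p.1.2 p.2 :=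
      measurable_fst.fst.mul (hF.comp (measurable_fst.snd.prodMk measurable_snd))
    calc ∫⁻ ω, ∏ i ∈ insert a s, F (e i ω) (z i ω) ∂μ
        = ∫⁻ ω, (fun p : (ℝ≥0∞ × ℝ) × ℝ => p.1.1 * F p.1.2 p.2) (Y ω, z a ω) ∂μ := by
          refine lintegral_congr fun ω => ?_
          rw [Finset.prod_insert has, mul_comm]
      _ = ∫⁻ p, p.1.1 * F p.1.2 p.2 ∂((μ.map Y).prod γ) := by
          rw [← hz a, ← hmap, lintegral_map hG (hYm.prodMk (hzm a))]
      _ = ∫⁻ y, ∫⁻ x, y.1 * F y.2 x ∂γ ∂(μ.map Y) := lintegral_prod _ hG.aemeasurable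
      _ ≤ ∫⁻ y, y.1 * K ∂(μ.map Y) := by
          refine lintegral_mono fun y => ?_
          have hy : Measurable (F y.2) := hF.comp measurable_prodMk_left
          rw [lintegral_const_mul _ hy]
          gcongr
          exact hK _
      _ = (∫⁻ ω, ∏ i ∈ s, F (e i ω) (z i ω) ∂μ) * K := by
          rw [lintegral_mul_const _ measurable_fst, lintegral_map measurable_fst hYm]
      _ ≤ K ^ s.card * K := by gcongr
      _ = K ^ (insert a s).card := by rw [Finset.card_insert_of_notMem has, pow_succ]

/-- The previous bound when the sequence is adapted only within each of `q` colour classes. -/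
theorem lintegral_prod_rpow_le_of_coloring [Fintype ι] {q : ℕ} (hq : 0 < q) (col : ι → Fin q)
    (hF : Measurable (Function.uncurry F))
    (hK : ∀ x, ∫⁻ y, F x y ∂γ ≤ K) (hzm : ∀ i, Measurable (z i)) (τ : ι → ℕ)
    (𝓕 : ι → MeasurableSpace Ω) (hle : ∀ i, 𝓕 i ≤ mΩ) (hz : ∀ i, μ.map (z i) = γ)
    (hind : ∀ i, Indep (𝓕 i) (MeasurableSpace.comap (z i) inferInstance) μ)
    (he : ∀ i, Measurable[𝓕 i] (e i))
    (hpast : ∀ i j, col i = col j → j ≠ i → τ j ≤ τ i →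
      Measurable[𝓕 i] (e j) ∧ Measurable[𝓕 i] (z j)) :
    ∫⁻ ω, ∏ i, F (e i ω) (z i ω) ^ (q : ℝ)⁻¹ ∂μ ≤ (K ^ (q : ℝ)⁻¹) ^ Fintype.card ι := by
  classical
  have hq' : (q : ℝ) ≠ 0 := by positivity
  have hfib : ∀ f : ι → ℝ≥0∞, ∏ i, f i = ∏ k : Fin q, ∏ i with col i = k, f i := fun f =>
    (Finset.prod_fiberwise _ _ _).symm
  have hmeas : ∀ i, Measurable fun ω => F (e i ω) (z i ω) := fun i =>
    hF.comp (((he i).mono (hle i) le_rfl).prodMk (hzm i))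
  calc ∫⁻ ω, ∏ i, F (e i ω) (z i ω) ^ (q : ℝ)⁻¹ ∂μ
      = ∫⁻ ω, ∏ k : Fin q, (∏ i with col i = k, F (e i ω) (z i ω)) ^ (q : ℝ)⁻¹ ∂μ := by
        refine lintegral_congr fun ω => ?_
        rw [hfib]
        refine Finset.prod_congr rfl fun k _ => ?_
        exact ENNReal.prod_rpow_of_nonneg (by positivity)
    -- Hölder with `q` equal weights `1 / q`; different colour classes may be arbitrarily dependent.
    _ ≤ ∏ k : Fin q, (∫⁻ ω, ∏ i with col i = k, F (e i ω) (z i ω) ∂μ) ^ (q : ℝ)⁻¹ := by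
        refine ENNReal.lintegral_prod_norm_pow_le _ (fun k _ => ?_) ?_ fun _ _ => by positivity
        · exact (Finset.measurable_fun_prod _ fun i _ => hmeas i).aemeasurable
        · simp [hq']
    _ ≤ ∏ k : Fin q, (K ^ (Finset.univ.filter fun i => col i = k).card) ^ (q : ℝ)⁻¹ := by
        refine Finset.prod_le_prod' fun k _ => ?_
        gcongr
        refine lintegral_prod_adapted_le hF hK hzm τ 𝓕 hle hz hind he _ fun i hi j hj => ?_
        simp only [Finset.mem_filter, Finset.mem_univ, true_and] at hi hj
        exact hpast i j (hi.trans hj.symm)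
    _ = ∏ k : Fin q, (K ^ (q : ℝ)⁻¹) ^ (Finset.univ.filter fun i => col i = k).card := by
        refine Finset.prod_congr rfl fun k _ => ?_
        rw [← ENNReal.rpow_natCast, ← ENNReal.rpow_natCast, ← ENNReal.rpow_mul,
          ← ENNReal.rpow_mul, mul_comm]
    _ = (K ^ (q : ℝ)⁻¹) ^ Fintype.card ι := by
        rw [Finset.prod_pow_eq_pow_sum, ← Finset.card_eq_sum_card_fiberwise (fun _ _ => by simp)]
        rfl

end Adapted

/-! ### Gaussian and subgaussian squares -/

section Squares

open scoped ENNReal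

theorem lintegral_exp_mul_gaussianReal (v : ℝ≥0) (t : ℝ) :
    ∫⁻ x, ENNReal.ofReal (Real.exp (t * x)) ∂(gaussianReal 0 v)
      = ENNReal.ofReal (Real.exp (v * t ^ 2 / 2)) := by
  rw [← ofReal_integral_eq_lintegral_ofReal (integrable_exp_mul_gaussianReal t)
    (ae_of_all _ fun _ => (Real.exp_pos _).le)]
  have := congrFun (mgf_fun_id_gaussianReal (μ := 0) (v := v)) t
  rw [mgf] at this
  rw [this]
  simp

theorem lintegral_exp_sq_gaussianReal {θ : ℝ} (hθ : θ < 1 / 2) :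
    ∫⁻ x, ENNReal.ofReal (Real.exp (θ * x ^ 2)) ∂(gaussianReal 0 1)
      = ENNReal.ofReal (√(1 - 2 * θ))⁻¹ := by
  have hb : 0 < 1 / 2 - θ := by linarith
  rw [gaussianReal_of_var_ne_zero _ one_ne_zero,
    lintegral_withDensity_eq_lintegral_mul _ (measurable_gaussianPDF _ _) (by fun_prop)]
  have h1 : ∀ x : ℝ, (gaussianPDF 0 1 * fun x => ENNReal.ofReal (Real.exp (θ * x ^ 2))) x
      = ENNReal.ofReal ((√(2 * Real.pi))⁻¹ * Real.exp (-(1 / 2 - θ) * x ^ 2)) := by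
    intro x
    rw [Pi.mul_apply, gaussianPDF, ← ENNReal.ofReal_mul (gaussianPDFReal_nonneg _ _ _),
      gaussianPDFReal, mul_assoc, ← Real.exp_add]
    simp only [NNReal.coe_one, mul_one, sub_zero]
    congr 3
    ring
  simp_rw [h1]
  rw [← ofReal_integral_eq_lintegral_ofReal ((integrable_exp_neg_mul_sq hb).const_mul _)
    (ae_of_all _ fun _ => by positivity), integral_const_mul, integral_gaussian]
  congr 1
  rw [← Real.sqrt_inv, ← Real.sqrt_inv, ← Real.sqrt_mul (by positivity)]
  congr 1
  have : 1 - 2 * θ ≠ 0 := by linarith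
  field_simp

/-- The exponential moment of the square of a subgaussian variable. -/
theorem _root_.ProbabilityTheory.HasSubgaussianMGF.lintegral_exp_sq_le {Ω : Type*} [MeasurableSpace Ω] {μ : Measure Ω}
    [IsProbabilityMeasure μ] {X : Ω → ℝ} {v : ℝ≥0} (hX : HasSubgaussianMGF X v μ)
    (hm : Measurable X) {θ : ℝ} (hθ : 0 ≤ θ) (hθv : 4 * θ * v ≤ 1) :
    ∫⁻ ω, ENNReal.ofReal (Real.exp (θ * X ω ^ 2)) ∂μ ≤ 2 := by
  have h2 : √(2 * θ) ^ 2 = 2 * θ := Real.sq_sqrt (by positivity)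
  -- Linearise the square with an auxiliary standard Gaussian, `exp (θ x²) = 𝔼 exp (√(2θ) x g)`, so
  -- that after Tonelli the subgaussian bound applies for each fixed `g`.
  calc ∫⁻ ω, ENNReal.ofReal (Real.exp (θ * X ω ^ 2)) ∂μ
      = ∫⁻ ω, ∫⁻ g, ENNReal.ofReal (Real.exp (√(2 * θ) * X ω * g)) ∂(gaussianReal 0 1) ∂μ := by
        refine lintegral_congr fun ω => ?_
        rw [lintegral_exp_mul_gaussianReal, mul_pow, h2]
        congr 2
        push_cast
        ring
    _ = ∫⁻ g, ∫⁻ ω, ENNReal.ofReal (Real.exp (√(2 * θ) * X ω * g)) ∂μ ∂(gaussianReal 0 1) :=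
        lintegral_lintegral_swap (by fun_prop)
    _ ≤ ∫⁻ g, ENNReal.ofReal (Real.exp (1 / 4 * g ^ 2)) ∂(gaussianReal 0 1) := by
        refine lintegral_mono fun g => ?_
        have h3 : ∀ ω, √(2 * θ) * X ω * g = (√(2 * θ) * g) * X ω := fun ω => by ring
        simp_rw [h3]
        rw [← ofReal_integral_eq_lintegral_ofReal (hX.integrable_exp_mul _)
          (ae_of_all _ fun _ => (Real.exp_pos _).le)]
        refine ENNReal.ofReal_le_ofReal ((hX.mgf_le _).trans (Real.exp_le_exp.2 ?_))
        rw [mul_pow, h2]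
        nlinarith [mul_le_mul_of_nonneg_right hθv (sq_nonneg g)]
    _ = ENNReal.ofReal (√(1 - 2 * (1 / 4)))⁻¹ := lintegral_exp_sq_gaussianReal (by norm_num)
    _ ≤ 2 := by
        rw [← ENNReal.ofReal_ofNat]
        refine ENNReal.ofReal_le_ofReal (inv_le_of_inv_le₀ (by norm_num) ?_)
        exact Real.le_sqrt_of_sq_le (by norm_num)

theorem lintegral_exp_sq_gaussianReal_div {σ : ℝ≥0} (hσ : 0 < σ) {θ : ℝ} (hθ : θ < 1 / 2) :
    ∫⁻ x, ENNReal.ofReal (Real.exp (θ * (x ^ 2 / σ ^ 2))) ∂(gaussianReal 0 (σ ^ 2))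
      = ENNReal.ofReal (√(1 - 2 * θ))⁻¹ := by
  have h : gaussianReal 0 (σ ^ 2) = (gaussianReal 0 1).map (fun x => (σ : ℝ) * x) := by
    rw [gaussianReal_map_const_mul]
    congr 1
    · simp
    · ext; simp
  rw [h, lintegral_map (by fun_prop) (by fun_prop), ← lintegral_exp_sq_gaussianReal hθ]
  refine lintegral_congr fun x => ?_
  congr 3
  field_simp

end Squares

/-! ### Tail bounds for sums over coloured adapted families. -/

section Tails

open scoped ENNReal

variable {Ω ι : Type*} [mΩ : MeasurableSpace Ω] {μ : Measure Ω} [IsProbabilityMeasure μ]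

/-- A family of pairs `(e i, z i)` split into colour classes such that `z i` has law `γ` and is
independent of `e i` and of all earlier pairs of its class. -/
structure ColoredAdapted (μ : Measure Ω) (γ : Measure ℝ) {q : ℕ} (col : ι → Fin q) (τ : ι → ℕ)
    (𝓕 : ι → MeasurableSpace Ω) (e z : ι → Ω → ℝ) : Prop where
  le : ∀ i, 𝓕 i ≤ mΩ
  law : ∀ i, μ.map (z i) = γ
  indep : ∀ i, Indep (𝓕 i) (MeasurableSpace.comap (z i) inferInstance) μ
  measurable : ∀ i, Measurable (z i)
  adapted : ∀ i, Measurable[𝓕 i] (e i)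
  past : ∀ i j, col i = col j → j ≠ i → τ j ≤ τ i →
    Measurable[𝓕 i] (e j) ∧ Measurable[𝓕 i] (z j)

namespace ColoredAdapted

variable {γ : Measure ℝ} [IsProbabilityMeasure γ] {q : ℕ} {col : ι → Fin q} {τ : ι → ℕ}
  {𝓕 : ι → MeasurableSpace Ω} {e z : ι → Ω → ℝ} [Fintype ι]

theorem lintegral_exp_le (h : ColoredAdapted μ γ col τ 𝓕 e z) (hq : 0 < q) {φ : ℝ → ℝ → ℝ}
    (hφ : Measurable (Function.uncurry φ)) {κ : ℝ}
    (hκ : ∀ x, ∫⁻ y, ENNReal.ofReal (Real.exp (φ x y)) ∂γ ≤ ENNReal.ofReal (Real.exp κ)) :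
    ∫⁻ ω, ENNReal.ofReal (Real.exp ((∑ i, φ (e i ω) (z i ω)) / q)) ∂μ
      ≤ ENNReal.ofReal (Real.exp (κ * Fintype.card ι / q)) := by
  have hpow : ∀ x : ℝ, ENNReal.ofReal (Real.exp x) ^ (q : ℝ)⁻¹
      = ENNReal.ofReal (Real.exp (x / q)) := fun x => by
    rw [ENNReal.ofReal_rpow_of_pos (Real.exp_pos _), ← Real.exp_mul, div_eq_mul_inv]
  have := lintegral_prod_rpow_le_of_coloring hq col
    (F := fun x y => ENNReal.ofReal (Real.exp (φ x y))) (hφ.exp.ennreal_ofReal) hκ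
    h.measurable τ 𝓕 h.le h.law h.indep h.adapted h.past
  simp_rw [hpow] at this
  rw [← ENNReal.ofReal_pow (Real.exp_pos _).le, ← Real.exp_nat_mul] at this
  convert! this using 3
  · rw [← ENNReal.ofReal_prod_of_nonneg fun _ _ => (Real.exp_pos _).le, ← Real.exp_sum,
      Finset.sum_div]
  · ring

variable {σ : ℝ≥0}

/-- Tail bound for `∑ e i * z i` with Gaussian `z i` and subgaussian `e i`. -/
theorem measure_sum_mul_ge_le [Nonempty ι]
    (h : ColoredAdapted μ (gaussianReal 0 (σ ^ 2)) col τ 𝓕 e z) (hq : 0 < q) (hσ : 0 < σ)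
    {v : ℝ≥0} (hv : 0 < v) (he : ∀ i, HasSubgaussianMGF (e i) v μ) (s : ℝ) :
    μ {ω | s * (σ * √(8 * q * v * Fintype.card ι)) ≤ ∑ i, e i ω * z i ω}
      ≤ ENNReal.ofReal (2 * Real.exp (-s)) := by
  have hem : ∀ i, Measurable (e i) := fun i => (h.adapted i).mono (h.le i) le_rfl
  have hzm := h.measurable
  set K : ℝ := (Fintype.card ι : ℝ) with hK
  have hK0 : 0 < K := by simp [hK, Fintype.card_pos]
  have hq0 : (0 : ℝ) < q := by exact_mod_cast hq
  have hv0 : (0 : ℝ) < v := hv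
  have hσ0 : (0 : ℝ) < σ := hσ
  set R : ℝ := σ * √(8 * q * v * K) with hR
  have hR0 : 0 < R := by positivity
  have hR2 : R ^ 2 = σ ^ 2 * (8 * q * v * K) := by
    rw [hR, mul_pow, Real.sq_sqrt (by positivity)]
  -- This choice makes the compensated sum divided by `q` equal to `2 (∑ e z) / R - (∑ e²) / (4 v
  -- K)`.
  set l : ℝ := 2 * q / R with hl
  set φ : ℝ → ℝ → ℝ := fun x y => l * x * y - l ^ 2 * σ ^ 2 * x ^ 2 / 2 with hφ
  -- For fixed `x`, the subtracted term of `φ` is exactly the log-moment of `l x z`, so each factor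
  -- has mean one.
  have h1 : ∫⁻ ω, ENNReal.ofReal (Real.exp ((∑ i, φ (e i ω) (z i ω)) / q)) ∂μ ≤ 1 := by
    refine (h.lintegral_exp_le hq (φ := φ) (κ := 0) ?_ fun x => ?_).trans (by simp)
    · simp only [hφ, Function.uncurry_def]; fun_prop
    · have : ∀ y, ENNReal.ofReal (Real.exp (φ x y))
          = ENNReal.ofReal (Real.exp (l * x * y))
            * ENNReal.ofReal (Real.exp (-(l ^ 2 * σ ^ 2 * x ^ 2 / 2))) := fun y => by
        rw [← ENNReal.ofReal_mul (Real.exp_pos _).le, ← Real.exp_add, hφ]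
        simp only [sub_eq_add_neg]
      simp_rw [this]
      rw [lintegral_mul_const _ (by fun_prop), lintegral_exp_mul_gaussianReal,
        ← ENNReal.ofReal_mul (Real.exp_pos _).le, ← Real.exp_add]
      refine le_of_eq ?_
      congr 2
      push_cast
      ring
  -- Jensen over the uniform average of the indices reduces to single squares; the `e i` need not be
  -- independent.
  have h2 : ∫⁻ ω, ENNReal.ofReal (Real.exp ((∑ i, e i ω ^ 2) / (4 * v * K))) ∂μ ≤ 2 := by
    have hconv : ∀ ω, Real.exp ((∑ i, e i ω ^ 2) / (4 * v * K))
        ≤ ∑ i, K⁻¹ * Real.exp (1 / (4 * v) * e i ω ^ 2) := fun ω => by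
      have := convexOn_exp.map_sum_le (t := Finset.univ) (w := fun _ : ι => K⁻¹)
        (p := fun i => 1 / (4 * v) * e i ω ^ 2) (fun _ _ => by positivity)
        (by simp [← hK, hK0.ne']) (fun _ _ => Set.mem_univ _)
      simp only [smul_eq_mul] at this
      convert! this using 2
      rw [← Finset.mul_sum, ← Finset.mul_sum]
      field_simp
    calc ∫⁻ ω, ENNReal.ofReal (Real.exp ((∑ i, e i ω ^ 2) / (4 * v * K))) ∂μ
        ≤ ∫⁻ ω, ∑ i, ENNReal.ofReal K⁻¹
            * ENNReal.ofReal (Real.exp (1 / (4 * v) * e i ω ^ 2)) ∂μ := by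
          refine lintegral_mono fun ω => (ENNReal.ofReal_le_ofReal (hconv ω)).trans ?_
          rw [ENNReal.ofReal_sum_of_nonneg fun _ _ => by positivity]
          exact le_of_eq (Finset.sum_congr rfl fun i _ =>
            ENNReal.ofReal_mul (by positivity))
      _ = ∑ i, ENNReal.ofReal K⁻¹
            * ∫⁻ ω, ENNReal.ofReal (Real.exp (1 / (4 * v) * e i ω ^ 2)) ∂μ := by
          rw [lintegral_finsetSum _ fun i _ => by have := hem i; fun_prop]
          refine Finset.sum_congr rfl fun i _ => ?_
          rw [lintegral_const_mul _ (by have := hem i; fun_prop)]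
      _ ≤ ∑ i : ι, ENNReal.ofReal K⁻¹ * 2 := by
          refine Finset.sum_le_sum fun i _ => ?_
          gcongr
          refine (he i).lintegral_exp_sq_le (hem i) (by positivity) (le_of_eq ?_)
          field_simp
      _ = 2 := by
          rw [Finset.sum_const, Finset.card_univ, nsmul_eq_mul, ← mul_assoc,
            ← ENNReal.ofReal_natCast, ← ENNReal.ofReal_mul (by positivity), ← hK,
            mul_inv_cancel₀ hK0.ne']
          simp
  -- With `a = (∑ e z) / R` and `b = (∑ e²) / (4 v K)`, AM-GM gives `exp a ≤ (exp (2a - b) + exp b)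
  -- / 2`, whose two terms are `h1` and `h2`.
  have h3 : ∫⁻ ω, ENNReal.ofReal (Real.exp ((∑ i, e i ω * z i ω) / R)) ∂μ ≤ 2 := by
    calc ∫⁻ ω, ENNReal.ofReal (Real.exp ((∑ i, e i ω * z i ω) / R)) ∂μ
        ≤ ∫⁻ ω, (ENNReal.ofReal (Real.exp ((∑ i, φ (e i ω) (z i ω)) / q))
            + ENNReal.ofReal (Real.exp ((∑ i, e i ω ^ 2) / (4 * v * K)))) / 2 ∂μ := by
          refine lintegral_mono fun ω => ?_
          have hsum : (∑ i, φ (e i ω) (z i ω)) / q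
              = 2 * ((∑ i, e i ω * z i ω) / R) - (∑ i, e i ω ^ 2) / (4 * v * K) := by
            have : ∑ i, φ (e i ω) (z i ω)
                = l * (∑ i, e i ω * z i ω) - l ^ 2 * σ ^ 2 / 2 * ∑ i, e i ω ^ 2 := by
              rw [Finset.mul_sum, Finset.mul_sum, ← Finset.sum_sub_distrib]
              refine Finset.sum_congr rfl fun i _ => ?_
              simp only [hφ]; ring
            rw [this, hl, div_pow, hR2]
            field_simp
            ring
          rw [hsum, ENNReal.le_div_iff_mul_le (by simp) (by simp),
            ← ENNReal.ofReal_add (Real.exp_pos _).le (Real.exp_pos _).le,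
            ← ENNReal.ofReal_ofNat, ← ENNReal.ofReal_mul (Real.exp_pos _).le]
          refine ENNReal.ofReal_le_ofReal ?_
          set a := (∑ i, e i ω * z i ω) / R
          set b := (∑ i, e i ω ^ 2) / (4 * v * K)
          have e1 : Real.exp (2 * a - b) = (Real.exp (a - b / 2)) ^ 2 := by
            rw [← Real.exp_nat_mul]; congr 1; push_cast; ring
          have e2 : Real.exp b = (Real.exp (b / 2)) ^ 2 := by
            rw [← Real.exp_nat_mul]; congr 1; push_cast; ring
          have e3 : Real.exp a = Real.exp (a - b / 2) * Real.exp (b / 2) := by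
            rw [← Real.exp_add]; congr 1; ring
          rw [e1, e2, e3]
          nlinarith [sq_nonneg (Real.exp (a - b / 2) - Real.exp (b / 2))]
      _ ≤ (1 + 2) / 2 := by
          simp_rw [div_eq_mul_inv]
          rw [lintegral_mul_const _ (by fun_prop), lintegral_add_left (by fun_prop)]
          gcongr
          · simpa only [div_eq_mul_inv] using h1
          · simpa only [div_eq_mul_inv] using h2
      _ ≤ 2 := by
          rw [ENNReal.div_le_iff (by simp) (by simp)]; norm_num
  have h4 := mul_meas_ge_le_lintegral (μ := μ)
    (f := fun ω => ENNReal.ofReal (Real.exp ((∑ i, e i ω * z i ω) / R))) (by fun_prop)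
    (ENNReal.ofReal (Real.exp s))
  have hsub : {ω | s * R ≤ ∑ i, e i ω * z i ω}
      ⊆ {ω | ENNReal.ofReal (Real.exp s)
        ≤ ENNReal.ofReal (Real.exp ((∑ i, e i ω * z i ω) / R))} := fun ω hω =>
    ENNReal.ofReal_le_ofReal (Real.exp_le_exp.2 ((le_div_iff₀ hR0).2 hω))
  calc μ {ω | s * R ≤ ∑ i, e i ω * z i ω} ≤ _ := measure_mono hsub
    _ ≤ 2 / ENNReal.ofReal (Real.exp s) := by
      rw [ENNReal.le_div_iff_mul_le (by simp [Real.exp_pos]) (by simp), mul_comm]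
      exact h4.trans h3
    _ = ENNReal.ofReal (2 * Real.exp (-s)) := by
      rw [Real.exp_neg, ← div_eq_mul_inv, ENNReal.ofReal_div_of_pos (Real.exp_pos _)]
      simp

/-- Chernoff bound for sums of squares of Gaussians. -/
theorem measure_sum_sq_le (h : ColoredAdapted μ (gaussianReal 0 (σ ^ 2)) col τ 𝓕 e z)
    (hq : 0 < q) (hσ : 0 < σ) {θ κ : ℝ} (hθ : θ < 1 / 2) (hκ : (√(1 - 2 * θ))⁻¹ ≤ Real.exp κ)
    (s : ℝ) :
    μ {ω | s * Fintype.card ι ≤ θ * (∑ i, z i ω ^ 2 / σ ^ 2)}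
      ≤ ENNReal.ofReal (Real.exp ((κ - s) * Fintype.card ι / q)) := by
  have hzm := h.measurable
  have hq0 : (0 : ℝ) < q := by exact_mod_cast hq
  have h1 := h.lintegral_exp_le hq (φ := fun _ y => θ * (y ^ 2 / σ ^ 2)) (κ := κ)
    (by simp only [Function.uncurry_def]; fun_prop)
    (fun x => by rw [lintegral_exp_sq_gaussianReal_div hσ hθ]; exact ENNReal.ofReal_le_ofReal hκ)
  have h4 := mul_meas_ge_le_lintegral (μ := μ)
    (f := fun ω => ENNReal.ofReal (Real.exp ((∑ i, θ * (z i ω ^ 2 / σ ^ 2)) / q)))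
    (by fun_prop) (ENNReal.ofReal (Real.exp (s * Fintype.card ι / q)))
  calc μ {ω | s * Fintype.card ι ≤ θ * (∑ i, z i ω ^ 2 / σ ^ 2)}
      ≤ μ {ω | ENNReal.ofReal (Real.exp (s * Fintype.card ι / q))
        ≤ ENNReal.ofReal (Real.exp ((∑ i, θ * (z i ω ^ 2 / σ ^ 2)) / q))} := by
        refine measure_mono fun ω hω => ENNReal.ofReal_le_ofReal (Real.exp_le_exp.2 ?_)
        rw [← Finset.mul_sum]
        exact div_le_div_of_nonneg_right hω hq0.le
    _ ≤ ENNReal.ofReal (Real.exp (κ * Fintype.card ι / q))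
        / ENNReal.ofReal (Real.exp (s * Fintype.card ι / q)) := by
      rw [ENNReal.le_div_iff_mul_le (by simp [Real.exp_pos]) (by simp), mul_comm]
      exact h4.trans h1
    _ = _ := by
      rw [← ENNReal.ofReal_div_of_pos (Real.exp_pos _), ← Real.exp_sub]
      congr 2
      ring

theorem measure_sum_sq_ge_le (h : ColoredAdapted μ (gaussianReal 0 (σ ^ 2)) col τ 𝓕 e z)
    (hq : 0 < q) (hσ : 0 < σ) :
    μ {ω | 4 * σ ^ 2 * Fintype.card ι ≤ ∑ i, z i ω ^ 2}
      ≤ ENNReal.ofReal (Real.exp (-(Fintype.card ι / (4 * q)))) := by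
  have hσ0 : (0 : ℝ) < σ := hσ
  refine (measure_mono fun ω hω => ?_).trans
    -- At `θ = 1/4` the Gaussian moment is `√2 ≤ 7/4 ≤ exp (3/4)`, and `κ - s = -1/4`.
    ((h.measure_sum_sq_le hq hσ (θ := 1 / 4) (κ := 3 / 4) (by norm_num) ?_ 1).trans_eq ?_)
  · simp only [Set.mem_ofPred_eq] at hω ⊢
    rw [← Finset.sum_div, ← mul_div_assoc, le_div_iff₀ (by positivity)]
    linarith
  · refine (inv_le_of_inv_le₀ (by norm_num) (Real.le_sqrt_of_sq_le (y := 1 - 2 * (1 / 4))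
      (x := (7 / 4)⁻¹) (by norm_num))).trans ?_
    linarith [Real.add_one_le_exp (3 / 4 : ℝ)]
  · congr 2
    field_simp
    ring

theorem measure_sum_sq_le_le (h : ColoredAdapted μ (gaussianReal 0 (σ ^ 2)) col τ 𝓕 e z)
    (hq : 0 < q) (hσ : 0 < σ) :
    μ {ω | ∑ i, z i ω ^ 2 ≤ σ ^ 2 * Fintype.card ι / 4}
      ≤ ENNReal.ofReal (Real.exp (-(Fintype.card ι / (4 * q)))) := by
  have hσ0 : (0 : ℝ) < σ := hσ
  refine (measure_mono fun ω hω => ?_).trans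
    -- A negative `θ` gives the lower tail. At `θ = -3/2` the moment is `1/2 ≤ exp (-5/8)`, and
    -- again `κ - s = -1/4`.
    ((h.measure_sum_sq_le hq hσ (θ := -3 / 2) (κ := -5 / 8) (by norm_num) ?_ (-3 / 8)).trans_eq ?_)
  · simp only [Set.mem_ofPred_eq] at hω ⊢
    rw [← Finset.sum_div, ← mul_div_assoc, le_div_iff₀ (by positivity)]
    linarith
  · have h4 : √(1 - 2 * (-3 / 2)) = 2 := by
      rw [show (1 - 2 * (-3 / 2) : ℝ) = 2 ^ 2 by norm_num, Real.sqrt_sq (by norm_num)]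
    rw [h4, ← Real.exp_log (show (0 : ℝ) < 2⁻¹ by norm_num), Real.log_inv, Real.exp_le_exp]
    linarith [Real.log_two_gt_d9]
  · congr 2
    field_simp
    ring

end ColoredAdapted

end Tails

/-! ### Spectral norms and pseudoinverses -/

section SpecNorm

variable {a b c : Type*} [Fintype a] [Fintype b] [Fintype c]

theorem norm_sq_toLp (x : a → ℝ) : ‖WithLp.toLp 2 x‖ ^ 2 = x ⬝ᵥ x := by
  rw [EuclideanSpace.norm_sq_eq]
  simp [dotProduct, sq]

theorem inner_toLp (x y : a → ℝ) :
    inner ℝ (WithLp.toLp 2 x) (WithLp.toLp 2 y) = x ⬝ᵥ y := by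
  simp [PiLp.inner_apply, dotProduct, mul_comm]

theorem dotProduct_le_norm_mul_norm (x y : a → ℝ) :
    x ⬝ᵥ y ≤ ‖WithLp.toLp 2 x‖ * ‖WithLp.toLp 2 y‖ := by
  rw [← inner_toLp]
  exact real_inner_le_norm _ _

/-- A lower bound for the singular values from the quadratic form on a net. -/
theorem le_norm_transpose_mulVec_of_net [DecidableEq a] (U : Matrix a b ℝ) {ε R r : ℝ} (hε : ε < 1) (hR : 0 ≤ R)
    {s : Set (EuclideanSpace ℝ a)}
    (hs : ∀ x : EuclideanSpace ℝ a, ‖x‖ = 1 → ∃ y ∈ s, ‖x - y‖ ≤ ε)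
    (hu : ∀ y ∈ s, ∑ j, (y.ofLp ⬝ᵥ Uᵀ j) ^ 2 ≤ R ^ 2)
    (hl : ∀ y ∈ s, r ^ 2 ≤ ∑ j, (y.ofLp ⬝ᵥ Uᵀ j) ^ 2) (x : a → ℝ) :
    (r - R / (1 - ε) * ε) * ‖WithLp.toLp 2 x‖ ≤ ‖WithLp.toLp 2 (Uᵀ *ᵥ x)‖ := by
  have hsq : ∀ y : EuclideanSpace ℝ a,
      ∑ j, (y.ofLp ⬝ᵥ Uᵀ j) ^ 2 = ‖(Matrix.toEuclideanLin Uᵀ).toContinuousLinearMap y‖ ^ 2 := by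
    intro y
    change _ = ‖WithLp.toLp 2 (Uᵀ *ᵥ y.ofLp)‖ ^ 2
    rw [norm_sq_toLp, dotProduct]
    refine Finset.sum_congr rfl fun j _ => ?_
    rw [sq, mulVec, dotProduct_comm]
  refine le_norm_of_net hε hR hs (Matrix.toEuclideanLin Uᵀ).toContinuousLinearMap
    (fun y hy => ?_) (fun y hy => ?_) (WithLp.toLp 2 x)
  · exact le_of_sq_le_sq (by rw [← hsq]; exact hu y hy) hR
  · exact le_of_sq_le_sq (by rw [← hsq]; exact hl y hy) (norm_nonneg _)

/-- Transposing the first Penrose condition shows that `Uᵀ` annihilates `(U U† - 1)ᵀ`; injectivity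
of `Uᵀ` concludes. -/
theorem mul_pinv_eq_one [DecidableEq a] (U : Matrix a b ℝ) (h : ∀ x, Uᵀ *ᵥ x = 0 → x = 0) :
    U * pinv U = 1 := by
  have hU := isMoorePenrose_pinv U
  have h1 : Uᵀ * (U * pinv U - 1)ᵀ = 0 := by
    rw [← transpose_mul, Matrix.sub_mul, hU.mul_mul_self, Matrix.one_mul, sub_self, transpose_zero]
  have h2 : (U * pinv U - 1)ᵀ = 0 := by
    ext i j
    have h3 := h ((U * pinv U - 1)ᵀ *ᵥ Pi.single j 1) (by rw [mulVec_mulVec, h1, zero_mulVec])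
    rw [mulVec_single_one] at h3
    exact congrFun h3 i
  exact sub_eq_zero.1 (transpose_eq_zero.1 h2)

variable [DecidableEq b]

theorem specNorm_nonneg (M : Matrix a b ℝ) : 0 ≤ specNorm M := norm_nonneg _

theorem norm_mulVec_le (M : Matrix a b ℝ) (x : b → ℝ) :
    ‖WithLp.toLp 2 (M *ᵥ x)‖ ≤ specNorm M * ‖WithLp.toLp 2 x‖ :=
  ((Matrix.toEuclideanLin M).toContinuousLinearMap).le_opNorm (WithLp.toLp 2 x)

theorem specNorm_le (M : Matrix a b ℝ) {R : ℝ} (hR : 0 ≤ R)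
    (h : ∀ x, ‖WithLp.toLp 2 (M *ᵥ x)‖ ≤ R * ‖WithLp.toLp 2 x‖) : specNorm M ≤ R :=
  ContinuousLinearMap.opNorm_le_bound _ hR fun x => h x.ofLp

theorem specNorm_mul_le [DecidableEq c] (M : Matrix a b ℝ) (N : Matrix b c ℝ) :
    specNorm (M * N) ≤ specNorm M * specNorm N := by
  refine specNorm_le _ (mul_nonneg (specNorm_nonneg _) (specNorm_nonneg _)) fun x => ?_
  rw [← mulVec_mulVec, mul_assoc]
  exact (norm_mulVec_le _ _).trans
    (mul_le_mul_of_nonneg_left (norm_mulVec_le _ _) (specNorm_nonneg _))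

theorem dotProduct_mulVec_le_specNorm (M : Matrix b b ℝ) (x : b → ℝ) :
    x ⬝ᵥ M *ᵥ x ≤ specNorm M * (x ⬝ᵥ x) := by
  calc x ⬝ᵥ M *ᵥ x ≤ ‖WithLp.toLp 2 x‖ * (specNorm M * ‖WithLp.toLp 2 x‖) :=
        (dotProduct_le_norm_mul_norm _ _).trans
          (mul_le_mul_of_nonneg_left (norm_mulVec_le _ _) (norm_nonneg _))
    _ = specNorm M * (x ⬝ᵥ x) := by rw [← norm_sq_toLp]; ring

theorem dotProduct_transpose_mulVec_self (M : Matrix a b ℝ) (x : a → ℝ) :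
    (Mᵀ *ᵥ x) ⬝ᵥ (Mᵀ *ᵥ x) ≤ specNorm M ^ 2 * (x ⬝ᵥ x) := by
  set y := Mᵀ *ᵥ x
  have h1 : y ⬝ᵥ y = x ⬝ᵥ M *ᵥ y := by
    rw [dotProduct_mulVec x, ← mulVec_transpose M x]
  have h2 : y ⬝ᵥ y ≤ ‖WithLp.toLp 2 x‖ * (specNorm M * ‖WithLp.toLp 2 y‖) :=
    h1.trans_le ((dotProduct_le_norm_mul_norm _ _).trans
      (mul_le_mul_of_nonneg_left (norm_mulVec_le _ _) (norm_nonneg _)))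
  rw [← norm_sq_toLp, ← norm_sq_toLp, ← mul_pow]
  rw [← norm_sq_toLp] at h2
  refine pow_le_pow_left₀ (norm_nonneg _) ?_ 2
  rcases (norm_nonneg (WithLp.toLp 2 y)).eq_or_lt with h | h
  · rw [← h]; exact mul_nonneg (specNorm_nonneg _) (norm_nonneg _)
  · refine le_of_mul_le_mul_right ?_ h
    linarith

/-- Spectral norms are controlled by the bilinear form on nets of the two unit spheres. -/
theorem specNorm_le_of_nets (M : Matrix a b ℝ) {ε R : ℝ} (hε : ε < 1) (hR : 0 ≤ R)
    {s : Set (EuclideanSpace ℝ a)} {t : Set (EuclideanSpace ℝ b)}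
    (hs : ∀ x : EuclideanSpace ℝ a, ‖x‖ = 1 → ∃ y ∈ s, ‖x - y‖ ≤ ε)
    (ht : ∀ x : EuclideanSpace ℝ b, ‖x‖ = 1 → ∃ y ∈ t, ‖x - y‖ ≤ ε)
    (h : ∀ x ∈ s, ∀ y ∈ t, x.ofLp ⬝ᵥ M *ᵥ y.ofLp ≤ R) : specNorm M ≤ R / (1 - ε) / (1 - ε) := by
  refine opNorm_le_of_net hε (div_nonneg hR (by linarith)) ht _ fun y hy => ?_
  refine norm_le_of_net hε hR hs _ fun x hx => ?_
  exact (inner_toLp x.ofLp (M *ᵥ y.ofLp)).trans_le (h x hx y hy)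

end SpecNorm

section Pinv

variable {a b c : Type*} [Fintype a] [Fintype b] [Fintype c] [DecidableEq a]

/-- `U† = Uᵀ H` with `H = (U†)ᵀ U†`, which inverts `U Uᵀ` and hence has norm at most `κ⁻²`. Keeping
`E Uᵀ` together preserves the cancellation between residuals and inputs, which `‖E‖ ‖U†‖` would
lose. -/
theorem specNorm_mul_pinv_le (E : Matrix c b ℝ) (U : Matrix a b ℝ) {κ : ℝ} (hκ : 0 < κ)
    (h : ∀ x, κ * ‖WithLp.toLp 2 x‖ ≤ ‖WithLp.toLp 2 (Uᵀ *ᵥ x)‖) :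
    specNorm (E * pinv U) ≤ specNorm (E * Uᵀ) / κ ^ 2 := by
  have hU := isMoorePenrose_pinv U
  have hone : U * pinv U = 1 := mul_pinv_eq_one U fun x hx => by
    have := h x
    rw [hx, WithLp.toLp_zero, norm_zero] at this
    have h0 : ‖WithLp.toLp 2 x‖ = 0 := le_antisymm (by nlinarith [norm_nonneg (WithLp.toLp 2 x)])
      (norm_nonneg _)
    simpa using h0
  set H := (pinv U)ᵀ * pinv U with hH
  have hpinv : pinv U = Uᵀ * H := by
    rw [hH, ← Matrix.mul_assoc, ← transpose_mul, hU.isSymm_right, hU.self_mul_mul]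
  have hUH : U * (Uᵀ * H) = 1 := by rw [← hpinv, hone]
  have hHn : specNorm H ≤ (κ ^ 2)⁻¹ := by
    refine specNorm_le _ (by positivity) fun x => ?_
    set y := H *ᵥ x with hy
    have h1 : ‖WithLp.toLp 2 (Uᵀ *ᵥ y)‖ ^ 2 = y ⬝ᵥ x := by
      rw [norm_sq_toLp, mulVec_transpose U y, ← dotProduct_mulVec, ← mulVec_transpose, hy,
        mulVec_mulVec, mulVec_mulVec, Matrix.mul_assoc, hUH, one_mulVec]
    have h2 := pow_le_pow_left₀ (mul_nonneg hκ.le (norm_nonneg _)) (h y) 2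
    have h3 := dotProduct_le_norm_mul_norm y x
    rw [h1, mul_pow] at h2
    rw [inv_mul_eq_div, le_div_iff₀ (by positivity)]
    rcases (norm_nonneg (WithLp.toLp 2 y)).eq_or_lt with h0 | h0
    · rw [← h0, zero_mul]; exact norm_nonneg _
    · refine le_of_mul_le_mul_left ?_ h0
      nlinarith
  calc specNorm (E * pinv U) = specNorm (E * Uᵀ * H) := by rw [Matrix.mul_assoc, ← hpinv]
    _ ≤ specNorm (E * Uᵀ) * specNorm H := specNorm_mul_le _ _
    _ ≤ specNorm (E * Uᵀ) * (κ ^ 2)⁻¹ := mul_le_mul_of_nonneg_left hHn (specNorm_nonneg _)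
    _ = _ := (div_eq_mul_inv _ _).symm

end Pinv

/-! ### Gramians of strictly stable systems -/

namespace LTI

section Gramian

variable {n m p : ℕ}

attribute [local instance] Matrix.frobeniusNormedAddCommGroup Matrix.frobeniusNormedSpace
  Matrix.frobeniusNormedRing Matrix.frobeniusNormedAlgebra

/-- By Gelfand's formula `‖Aᵗ‖ ≤ rᵗ` eventually, for some `r < 1`. The Frobenius norm is unchanged
by complexification. -/
theorem StrictlyStable.summable_norm_pow_sq {M : LTI n m p} (hM : M.StrictlyStable) :
    Summable fun t : ℕ => ‖M.A ^ t‖ ^ 2 := by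
  set a : Matrix (Fin n) (Fin n) ℂ := M.A.map (algebraMap ℝ ℂ) with ha
  have hnorm : ∀ t : ℕ, ‖M.A ^ t‖ = ‖a ^ t‖ := fun t => by
    have h1 : a ^ t = (M.A ^ t).map (algebraMap ℝ ℂ) := (map_pow (algebraMap ℝ ℂ).mapMatrix M.A t).symm
    rw [h1, Matrix.frobenius_norm_map_eq _ _ fun x => by simp]
  obtain ⟨r, hr, hr1⟩ := ENNReal.lt_iff_exists_nnreal_btwn.1 hM
  have hlim := spectrum.pow_nnnorm_pow_one_div_tendsto_nhds_spectralRadius a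
  have hev : ∀ᶠ t : ℕ in Filter.atTop, ‖M.A ^ t‖ ^ 2 ≤ ((r : ℝ) ^ 2) ^ t := by
    filter_upwards [hlim.eventually_lt_const hr, Filter.eventually_gt_atTop 0] with t ht ht0
    have ht' : (t : ℝ) ≠ 0 := by positivity
    rw [← ENNReal.coe_rpow_of_nonneg _ (by positivity), ENNReal.coe_lt_coe] at ht
    have h2 : ‖a ^ t‖₊ ≤ r ^ t := by
      have := pow_le_pow_left' ht.le t
      rwa [← NNReal.rpow_natCast, ← NNReal.rpow_mul, one_div, inv_mul_cancel₀ ht',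
        NNReal.rpow_one] at this
    have h3 : ‖a ^ t‖ ≤ (r : ℝ) ^ t := by exact_mod_cast h2
    rw [hnorm, ← pow_mul, mul_comm, pow_mul]
    exact pow_le_pow_left₀ (norm_nonneg _) h3 2
  have hr1' : (r : ℝ) < 1 := by exact_mod_cast hr1
  refine Summable.of_norm_bounded_eventually_nat
    (summable_geometric_of_lt_one (by positivity) (pow_lt_one₀ r.2 hr1' two_ne_zero)) ?_
  filter_upwards [hev] with t ht
  rwa [Real.norm_of_nonneg (by positivity)]

/-- Without summability the `tsum` in `gramian` would default to zero and control nothing. -/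
theorem StrictlyStable.summable_gramian {M : LTI n m p} (hM : M.StrictlyStable) (σu σw : ℝ) :
    Summable fun t : ℕ => σu ^ 2 • ((M.A ^ t * M.B) * (M.A ^ t * M.B)ᵀ)
      + σw ^ 2 • (M.A ^ t * (M.A ^ t)ᵀ) := by
  refine Summable.of_norm_bounded
    (hM.summable_norm_pow_sq.mul_left (σu ^ 2 * ‖M.B‖ ^ 2 + σw ^ 2)) fun t => ?_
  have h1 := Matrix.frobenius_norm_mul (M.A ^ t * M.B) (M.A ^ t * M.B)ᵀ
  have h2 := Matrix.frobenius_norm_mul (M.A ^ t) M.B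
  have h3 := Matrix.frobenius_norm_mul (M.A ^ t) (M.A ^ t)ᵀ
  rw [Matrix.frobenius_norm_transpose] at h1 h3
  refine (norm_add_le _ _).trans ?_
  rw [norm_smul, norm_smul, Real.norm_of_nonneg (sq_nonneg σu), Real.norm_of_nonneg (sq_nonneg σw)]
  have h4 : ‖M.A ^ t * M.B * (M.A ^ t * M.B)ᵀ‖ ≤ ‖M.B‖ ^ 2 * ‖M.A ^ t‖ ^ 2 :=
    h1.trans ((mul_self_le_mul_self (norm_nonneg _) h2).trans_eq (by ring))
  nlinarith [mul_le_mul_of_nonneg_left h4 (sq_nonneg σu),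
    mul_le_mul_of_nonneg_left h3 (sq_nonneg σw)]

theorem StrictlyStable.summable_obsGramian {M : LTI n m p} (hM : M.StrictlyStable) :
    Summable fun t : ℕ => (M.C * M.A ^ t) * (M.C * M.A ^ t)ᵀ := by
  refine Summable.of_norm_bounded (hM.summable_norm_pow_sq.mul_left (‖M.C‖ ^ 2)) fun t => ?_
  have h1 := Matrix.frobenius_norm_mul (M.C * M.A ^ t) (M.C * M.A ^ t)ᵀ
  have h2 := Matrix.frobenius_norm_mul M.C (M.A ^ t)
  rw [Matrix.frobenius_norm_transpose] at h1
  exact h1.trans ((mul_self_le_mul_self (norm_nonneg _) h2).trans_eq (by ring))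

end Gramian

variable {n m p : ℕ}

/-- The quadratic form `X ↦ a' X a` as an additive map. -/
def _root_.Matrix.quadForm {k : ℕ} (a : Fin k → ℝ) : Matrix (Fin k) (Fin k) ℝ →+ ℝ where
  toFun X := a ⬝ᵥ X *ᵥ a
  map_zero' := by simp
  map_add' X Y := by rw [add_mulVec, dotProduct_add]

theorem _root_.Matrix.continuous_quadForm {k : ℕ} (a : Fin k → ℝ) :
    Continuous (Matrix.quadForm a) := by
  change Continuous fun X : Matrix (Fin k) (Fin k) ℝ => a ⬝ᵥ X *ᵥ a
  fun_prop

theorem _root_.Matrix.dotProduct_mul_transpose_mulVec {k l : ℕ} (X : Matrix (Fin k) (Fin l) ℝ)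
    (a : Fin k → ℝ) : a ⬝ᵥ (X * Xᵀ) *ᵥ a = (Xᵀ *ᵥ a) ⬝ᵥ (Xᵀ *ᵥ a) := by
  rw [← mulVec_mulVec, dotProduct_mulVec, ← mulVec_transpose]

theorem _root_.Matrix.dotProduct_self_nonneg_real {k : ℕ} (a : Fin k → ℝ) : 0 ≤ a ⬝ᵥ a :=
  Finset.sum_nonneg fun _ _ => mul_self_nonneg _

/-- Partial sums of nonnegative terms. The `σw` terms are dropped because the noise is charged to
`obsGramian` instead. -/
theorem sum_le_gramian {M : LTI n m p} (hM : M.StrictlyStable) (σu σw : ℝ) (s : Finset ℕ)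
    (a : Fin n → ℝ) :
    ∑ t ∈ s, σu ^ 2 * (((M.A ^ t * M.B)ᵀ *ᵥ a) ⬝ᵥ ((M.A ^ t * M.B)ᵀ *ᵥ a))
      ≤ a ⬝ᵥ M.gramian σu σw *ᵥ a := by
  have hs : HasSum _ (Matrix.quadForm a (M.gramian σu σw)) :=
    (hM.summable_gramian σu σw).hasSum.map (Matrix.quadForm a) (Matrix.continuous_quadForm a)
  have hterm : ∀ t, (Matrix.quadForm a ∘ fun t : ℕ =>
      σu ^ 2 • ((M.A ^ t * M.B) * (M.A ^ t * M.B)ᵀ) + σw ^ 2 • (M.A ^ t * (M.A ^ t)ᵀ)) t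
      = σu ^ 2 * (((M.A ^ t * M.B)ᵀ *ᵥ a) ⬝ᵥ ((M.A ^ t * M.B)ᵀ *ᵥ a))
        + σw ^ 2 * (((M.A ^ t)ᵀ *ᵥ a) ⬝ᵥ ((M.A ^ t)ᵀ *ᵥ a)) := fun t => by
    simp only [Function.comp, map_add]
    simp only [Matrix.quadForm, AddMonoidHom.coe_mk, ZeroHom.coe_mk, smul_mulVec, dotProduct_smul,
      smul_eq_mul, Matrix.dotProduct_mul_transpose_mulVec]
  refine (Finset.sum_le_sum fun t _ => ?_).trans (sum_le_hasSum s (fun t _ => ?_) hs)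
  · rw [hterm]
    have := Matrix.dotProduct_self_nonneg_real ((M.A ^ t)ᵀ *ᵥ a)
    nlinarith [mul_nonneg (sq_nonneg σw) this]
  · rw [hterm]
    have h1 := Matrix.dotProduct_self_nonneg_real ((M.A ^ t)ᵀ *ᵥ a)
    have h2 := Matrix.dotProduct_self_nonneg_real ((M.A ^ t * M.B)ᵀ *ᵥ a)
    positivity

theorem sum_le_obsGramian {M : LTI n m p} (hM : M.StrictlyStable) (s : Finset ℕ)
    (a : Fin p → ℝ) :
    a ⬝ᵥ a + ∑ t ∈ s, ((M.C * M.A ^ t)ᵀ *ᵥ a) ⬝ᵥ ((M.C * M.A ^ t)ᵀ *ᵥ a)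
      ≤ a ⬝ᵥ M.obsGramian *ᵥ a := by
  have hs : HasSum _ (Matrix.quadForm a (∑' t : ℕ, (M.C * M.A ^ t) * (M.C * M.A ^ t)ᵀ)) :=
    hM.summable_obsGramian.hasSum.map (Matrix.quadForm a) (Matrix.continuous_quadForm a)
  have hterm : ∀ t, (Matrix.quadForm a ∘ fun t : ℕ => (M.C * M.A ^ t) * (M.C * M.A ^ t)ᵀ) t
      = ((M.C * M.A ^ t)ᵀ *ᵥ a) ⬝ᵥ ((M.C * M.A ^ t)ᵀ *ᵥ a) := fun t =>
    Matrix.dotProduct_mul_transpose_mulVec _ _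
  rw [LTI.obsGramian, add_mulVec, dotProduct_add, one_mulVec]
  gcongr
  refine (Finset.sum_le_sum fun t _ => (hterm t).ge).trans (sum_le_hasSum s (fun t _ => ?_) hs)
  rw [hterm]
  exact Matrix.dotProduct_self_nonneg_real _

/-! ### The regression error -/

/-- The part of the output at time `t` that is not explained by the inputs at times `t - L, …, t`. -/
def residual (M : LTI n m p) (L : ℕ) (u : ℕ → Fin m → ℝ) (w₁ : ℕ → Fin n → ℝ)
    (w₂ : ℕ → Fin p → ℝ) (t : ℕ) : Fin p → ℝ :=
  ∑ s ∈ Finset.range (t - L), (M.C * M.A ^ (t - 1 - s) * M.B) *ᵥ u s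
    + ∑ s ∈ Finset.range t, (M.C * M.A ^ (t - 1 - s)) *ᵥ w₁ s + w₂ t

theorem state_eq_sum (M : LTI n m p) (u : ℕ → Fin m → ℝ) (w₁ : ℕ → Fin n → ℝ) (t : ℕ) :
    M.state u w₁ t = ∑ s ∈ Finset.range t, (M.A ^ (t - 1 - s) * M.B) *ᵥ u s
      + ∑ s ∈ Finset.range t, M.A ^ (t - 1 - s) *ᵥ w₁ s := by
  induction t with
  | zero => simp [state]
  | succ t ih =>
    have hpow : ∀ s ∈ Finset.range t, M.A ^ (t + 1 - 1 - s) = M.A * M.A ^ (t - 1 - s) :=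
      fun s hs => by
        rw [← pow_succ']
        congr 1
        have := Finset.mem_range.1 hs
        omega
    rw [state, ih, Finset.sum_range_succ, Finset.sum_range_succ, mulVec_add, mulVec_sum, mulVec_sum]
    have h1 : ∑ s ∈ Finset.range t, (M.A ^ (t + 1 - 1 - s) * M.B) *ᵥ u s
        = ∑ s ∈ Finset.range t, M.A *ᵥ (M.A ^ (t - 1 - s) * M.B) *ᵥ u s :=
      Finset.sum_congr rfl fun s hs => by rw [hpow s hs, mulVec_mulVec, Matrix.mul_assoc]
    have h2 : ∑ s ∈ Finset.range t, M.A ^ (t + 1 - 1 - s) *ᵥ w₁ s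
        = ∑ s ∈ Finset.range t, M.A *ᵥ M.A ^ (t - 1 - s) *ᵥ w₁ s :=
      Finset.sum_congr rfl fun s hs => by rw [hpow s hs, mulVec_mulVec]
    rw [h1, h2]
    simp only [Nat.add_sub_cancel, Nat.sub_self, pow_zero, Matrix.one_mul, one_mulVec]
    abel

/-- The inputs of the last `L` steps are reindexed by lag; `L ≤ t` keeps `t - k` from truncating. -/
theorem output_eq (M : LTI n m p) {L : ℕ} (u : ℕ → Fin m → ℝ) (w₁ : ℕ → Fin n → ℝ)
    (w₂ : ℕ → Fin p → ℝ) {t : ℕ} (ht : L ≤ t) :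
    M.output u w₁ w₂ t
      = ∑ k ∈ Finset.range (L + 1), M.markov k *ᵥ u (t - k) + M.residual L u w₁ w₂ t := by
  have hsplit : ∑ s ∈ Finset.range t, (M.C * M.A ^ (t - 1 - s) * M.B) *ᵥ u s
      = ∑ s ∈ Finset.range (t - L), (M.C * M.A ^ (t - 1 - s) * M.B) *ᵥ u s
        + ∑ k ∈ Finset.range L, M.markov (k + 1) *ᵥ u (t - (k + 1)) := by
    obtain ⟨r, rfl⟩ := Nat.exists_eq_add_of_le' ht
    rw [Nat.add_sub_cancel, Finset.sum_range_add]
    congr 1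
    rw [← Finset.sum_range_reflect]
    refine Finset.sum_congr rfl fun k hk => ?_
    have := Finset.mem_range.1 hk
    rw [markov, show r + L - 1 - (r + (L - 1 - k)) = k by omega,
      show r + (L - 1 - k) = r + L - (k + 1) by omega]
  rw [output, state_eq_sum, residual, Finset.sum_range_succ', mulVec_add, mulVec_sum, mulVec_sum]
  simp only [mulVec_mulVec, ← Matrix.mul_assoc]
  rw [hsplit, markov, Nat.sub_zero]
  abel

theorem outputMatrix_eq (M : LTI n m p) {N : ℕ} (L Tbar : ℕ) (u : Fin N → ℕ → Fin m → ℝ)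
    (w₁ : Fin N → ℕ → Fin n → ℝ) (w₂ : Fin N → ℕ → Fin p → ℝ) :
    outputMatrix L Tbar (fun i => M.output (u i) (w₁ i) (w₂ i))
      = M.markovMatrix L * inputMatrix L Tbar u
        + outputMatrix L Tbar fun i => M.residual L (u i) (w₁ i) (w₂ i) := by
  ext a c
  rw [Matrix.add_apply, outputMatrix, outputMatrix, of_apply, of_apply,
    output_eq M _ _ _ (Nat.le_add_right L _), Pi.add_apply, Matrix.mul_apply,
    Fintype.sum_prod_type, Finset.sum_apply, Finset.sum_range]
  rfl

end LTI

/-! ### Linear forms of Gaussian and subgaussian vectors. -/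

section LinearForms

variable {Ω : Type*} [MeasurableSpace Ω] {μ : Measure Ω}

theorem measurable_dotProduct {k : ℕ} {w : Ω → Fin k → ℝ} (hw : Measurable w) (b : Fin k → ℝ) :
    Measurable fun ω => b ⬝ᵥ w ω :=
  (by fun_prop : Continuous fun x : Fin k → ℝ => b ⬝ᵥ x).measurable.comp hw

theorem measurable_mulVec {k l : ℕ} {w : Ω → Fin k → ℝ} (hw : Measurable w)
    (X : Matrix (Fin l) (Fin k) ℝ) : Measurable fun ω => X *ᵥ w ω :=
  (by fun_prop : Continuous fun x : Fin k → ℝ => X *ᵥ x).measurable.comp hw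

/-- Stated for an arbitrary σ-algebra so as to apply to `outsideSigma`: only inputs before `t - L`
are required to be measurable. -/
theorem LTI.measurable_dotProduct_residual {n m p : ℕ} (M : LTI n m p) (L : ℕ)
    {u : ℕ → Ω → Fin m → ℝ} {w₁ : ℕ → Ω → Fin n → ℝ} {w₂ : ℕ → Ω → Fin p → ℝ} {t : ℕ}
    (hu : ∀ s < t - L, Measurable (u s)) (h₁ : ∀ s, Measurable (w₁ s))
    (h₂ : ∀ s, Measurable (w₂ s)) (a : Fin p → ℝ) :
    Measurable fun ω => a ⬝ᵥ M.residual L (fun t => u t ω) (fun t => w₁ t ω) (fun t => w₂ t ω) t := by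
  refine measurable_dotProduct ?_ a
  simp only [LTI.residual]
  refine ((Finset.measurable_fun_sum _ fun s hs => ?_).add
    (Finset.measurable_fun_sum _ fun s _ => ?_)).add (h₂ t)
  · exact measurable_mulVec (hu s (Finset.mem_range.1 hs)) _
  · exact measurable_mulVec (h₁ s) _

theorem ProbabilityTheory.HasSubgaussianMGF.of_le {X : Ω → ℝ} {v v' : ℝ≥0}
    (h : HasSubgaussianMGF X v μ) (hv : v ≤ v') : HasSubgaussianMGF X v' μ where
  integrable_exp_mul := h.integrable_exp_mul
  mgf_le t := (h.mgf_le t).trans (Real.exp_le_exp.2 (by gcongr))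

theorem ProbabilityTheory.HasSubgaussianMGF.of_map_eq_gaussianReal {X : Ω → ℝ} {v : ℝ≥0}
    (hX : Measurable X) (h : μ.map X = gaussianReal 0 v) : HasSubgaussianMGF X v μ where
  integrable_exp_mul t := by
    have := integrable_exp_mul_gaussianReal (μ := 0) (v := v) t
    rw [← h] at this
    exact (integrable_map_measure (by fun_prop) hX.aemeasurable).1 this
  mgf_le t := by
    rw [mgf_gaussianReal h]
    simp

theorem IsSubgaussianVector.dotProduct [IsProbabilityMeasure μ] {k : ℕ} {w : Ω → Fin k → ℝ}
    {v : ℝ≥0} (hw : IsSubgaussianVector w v μ) (b : Fin k → ℝ) :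
    HasSubgaussianMGF (fun ω => b ⬝ᵥ w ω) ((b ⬝ᵥ b).toNNReal * v) μ := by
  have hb0 := Matrix.dotProduct_self_nonneg_real b
  rcases hb0.eq_or_lt with hb | hb
  · rw [dotProduct_self_eq_zero.1 hb.symm]
    simp
  · have hs : 0 < √(b ⬝ᵥ b) := Real.sqrt_pos.2 hb
    have h1 := (hw ((√(b ⬝ᵥ b))⁻¹ • b) (by
      rw [smul_dotProduct, dotProduct_smul, smul_eq_mul, smul_eq_mul, ← mul_assoc, ← mul_inv,
        Real.mul_self_sqrt hb0, inv_mul_cancel₀ hb.ne'])).const_mul (√(b ⬝ᵥ b))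
    convert! h1 using 1
    · ext ω
      rw [smul_dotProduct, smul_eq_mul, mul_inv_cancel_left₀ hs.ne']
    · congr 1
      ext
      rw [Real.coe_toNNReal _ hb0]
      exact (Real.sq_sqrt hb0).symm

/-- A finite sum of independent centred Gaussian variables is Gaussian. -/
theorem map_sum_eq_gaussianReal {ι : Type*} {X : ι → Ω → ℝ}
    (hind : iIndepFun X μ) (hX : ∀ i, Measurable (X i)) {v : ι → ℝ≥0}
    (h : ∀ i, μ.map (X i) = gaussianReal 0 (v i)) (s : Finset ι) :
    μ.map (∑ i ∈ s, X i) = gaussianReal 0 (∑ i ∈ s, v i) := by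
  classical
  have := hind.isProbabilityMeasure
  induction s using Finset.induction_on with
  | empty =>
    rw [Finset.sum_empty, Finset.sum_empty, gaussianReal_zero_var]
    change μ.map (fun _ => (0 : ℝ)) = _
    simp
  | insert i s his ih =>
    rw [Finset.sum_insert his, Finset.sum_insert his,
      gaussianReal_add_gaussianReal_of_indepFun
        (hind.indepFun_finsetSum_of_notMem hX his).symm (h i) ih, add_zero]

theorem map_dotProduct_eq_gaussianReal {k : ℕ} {w : Ω → Fin k → ℝ} {v : ℝ≥0} (hw : Measurable w)
    (h : μ.map w = Measure.pi fun _ => gaussianReal 0 v) (b : Fin k → ℝ) :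
    μ.map (fun ω => b ⬝ᵥ w ω) = gaussianReal 0 ((b ⬝ᵥ b).toNNReal * v) := by
  have hb : Measurable fun x : Fin k → ℝ => b ⬝ᵥ x := measurable_dotProduct measurable_id b
  have h1 : μ.map (fun ω => b ⬝ᵥ w ω)
      = (Measure.pi fun _ : Fin k => gaussianReal 0 v).map fun x => b ⬝ᵥ x := by
    rw [← h, Measure.map_map hb hw]
    rfl
  have hind : iIndepFun (fun (i : Fin k) (x : Fin k → ℝ) => b i * x i)
      (Measure.pi fun _ : Fin k => gaussianReal 0 v) :=
    iIndepFun_pi (X := fun i x => b i * x) fun i => by fun_prop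
  have h2 := map_sum_eq_gaussianReal hind (fun i => by fun_prop)
    (v := fun i => (b i ^ 2).toNNReal * v) (fun i => by
      have h3 : (fun x : Fin k → ℝ => b i * x i) = (fun y => b i * y) ∘ Function.eval i := rfl
      have h4 : Measurable (Function.eval i : (Fin k → ℝ) → ℝ) := measurable_pi_apply i
      rw [h3, ← Measure.map_map (by fun_prop) h4, (measurePreserving_eval _ i).map_eq,
        gaussianReal_map_const_mul, mul_zero]
      congr 2
      exact NNReal.eq (Real.coe_toNNReal _ (sq_nonneg _)).symm) Finset.univ
  rw [h1]
  convert! h2 using 2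
  · ext x
    simp [dotProduct]
  · rw [← Finset.sum_mul, ← Real.toNNReal_sum_of_nonneg fun _ _ => sq_nonneg _]
    simp [dotProduct, sq]

end LinearForms

/-! ### Independence structure of the trajectories -/

section Sources

variable {Ω : Type*} {N n m p : ℕ}
  {u : Fin N → ℕ → Ω → Fin m → ℝ} {w₁ : Fin N → ℕ → Ω → Fin n → ℝ} {w₂ : Fin N → ℕ → Ω → Fin p → ℝ}

/-- The σ-algebra generated by a single input or noise vector. -/
@[reducible] def sourceSigma (u : Fin N → ℕ → Ω → Fin m → ℝ) (w₁ : Fin N → ℕ → Ω → Fin n → ℝ)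
    (w₂ : Fin N → ℕ → Ω → Fin p → ℝ) (k : (Fin N × ℕ) ⊕ (Fin N × ℕ) ⊕ (Fin N × ℕ)) :
    MeasurableSpace Ω :=
  Sum.elim (fun a => MeasurableSpace.comap (u a.1 a.2) inferInstance)
    (Sum.elim (fun a => MeasurableSpace.comap (w₁ a.1 a.2) inferInstance)
      (fun a => MeasurableSpace.comap (w₂ a.1 a.2) inferInstance)) k

/-- The σ-algebra generated by all sources except the inputs of trajectory `i` at times
`s, …, s + L`. -/
@[reducible] def outsideSigma (u : Fin N → ℕ → Ω → Fin m → ℝ) (w₁ : Fin N → ℕ → Ω → Fin n → ℝ)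
    (w₂ : Fin N → ℕ → Ω → Fin p → ℝ) (L : ℕ) (i : Fin N) (s : ℕ) : MeasurableSpace Ω :=
  ⨆ k ∈ (Sum.inl '' {a : Fin N × ℕ | a.1 = i ∧ s ≤ a.2 ∧ a.2 ≤ s + L})ᶜ, sourceSigma u w₁ w₂ k

theorem measurable_outsideSigma_input {L : ℕ} {i j : Fin N} {s t : ℕ}
    (h : ¬(j = i ∧ s ≤ t ∧ t ≤ s + L)) : Measurable[outsideSigma u w₁ w₂ L i s] (u j t) := by
  refine measurable_iff_comap_le.2 ?_
  have hk : (Sum.inl (j, t) : (Fin N × ℕ) ⊕ (Fin N × ℕ) ⊕ (Fin N × ℕ))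
      ∈ (Sum.inl '' {a : Fin N × ℕ | a.1 = i ∧ s ≤ a.2 ∧ a.2 ≤ s + L})ᶜ := by
    rintro ⟨a, ha, hak⟩
    cases hak
    exact h ha
  exact le_biSup (sourceSigma u w₁ w₂) hk

theorem measurable_outsideSigma_process {L : ℕ} {i j : Fin N} {s t : ℕ} :
    Measurable[outsideSigma u w₁ w₂ L i s] (w₁ j t) := by
  refine measurable_iff_comap_le.2 ?_
  have hk : (Sum.inr (Sum.inl (j, t)) : (Fin N × ℕ) ⊕ (Fin N × ℕ) ⊕ (Fin N × ℕ))
      ∈ (Sum.inl '' {a : Fin N × ℕ | a.1 = i ∧ s ≤ a.2 ∧ a.2 ≤ s + L})ᶜ := by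
    rintro ⟨a, ha, hak⟩
    cases hak
  exact le_biSup (sourceSigma u w₁ w₂) hk

theorem measurable_outsideSigma_measurement {L : ℕ} {i j : Fin N} {s t : ℕ} :
    Measurable[outsideSigma u w₁ w₂ L i s] (w₂ j t) := by
  refine measurable_iff_comap_le.2 ?_
  have hk : (Sum.inr (Sum.inr (j, t)) : (Fin N × ℕ) ⊕ (Fin N × ℕ) ⊕ (Fin N × ℕ))
      ∈ (Sum.inl '' {a : Fin N × ℕ | a.1 = i ∧ s ≤ a.2 ∧ a.2 ≤ s + L})ᶜ := by
    rintro ⟨a, ha, hak⟩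
    cases hak
  exact le_biSup (sourceSigma u w₁ w₂) hk

/-- The marginal along `b` of the stacked input vector with latest entry at time `s + L`. -/
def stackedInput (L : ℕ) (b : Fin (L + 1) × Fin m → ℝ) (u : ℕ → Ω → Fin m → ℝ) (s : ℕ) (ω : Ω) : ℝ :=
  ∑ k : Fin (L + 1), (fun j => b (k, j)) ⬝ᵥ u (L + s - k) ω

variable [mΩ : MeasurableSpace Ω] {μ : Measure Ω} {σu σ₁ σ₂ : ℝ≥0}

namespace TrajectoryModel

theorem sourceSigma_le (hT : TrajectoryModel μ u w₁ w₂ σu σ₁ σ₂)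
    (k : (Fin N × ℕ) ⊕ (Fin N × ℕ) ⊕ (Fin N × ℕ)) : sourceSigma u w₁ w₂ k ≤ mΩ := by
  rcases k with a | a | a
  · exact (hT.measurable_input a.1 a.2).comap_le
  · exact (hT.measurable_process a.1 a.2).comap_le
  · exact (hT.measurable_measurement a.1 a.2).comap_le

theorem outsideSigma_le (hT : TrajectoryModel μ u w₁ w₂ σu σ₁ σ₂) (L : ℕ) (i : Fin N) (s : ℕ) :
    outsideSigma u w₁ w₂ L i s ≤ mΩ :=
  iSup₂_le fun k _ => hT.sourceSigma_le k

end TrajectoryModel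

theorem measurable_stackedInput {L : ℕ} (b : Fin (L + 1) × Fin m → ℝ) {u : ℕ → Ω → Fin m → ℝ}
    {s : ℕ} (hu : ∀ t, s ≤ t → t ≤ s + L → Measurable (u t)) :
    Measurable (stackedInput L b u s) :=
  Finset.measurable_fun_sum _ fun k _ =>
    measurable_dotProduct (hu _ (by omega) (by omega)) _

namespace TrajectoryModel

theorem indep_outsideSigma_stackedInput (hT : TrajectoryModel μ u w₁ w₂ σu σ₁ σ₂) {L : ℕ}
    (b : Fin (L + 1) × Fin m → ℝ) (i : Fin N) (s : ℕ) :
    Indep (outsideSigma u w₁ w₂ L i s)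
      (MeasurableSpace.comap (stackedInput L b (u i) s) inferInstance) μ := by
  have h := indep_iSup_of_disjoint hT.sourceSigma_le hT.indep
    (disjoint_compl_left (a := Sum.inl '' {a : Fin N × ℕ | a.1 = i ∧ s ≤ a.2 ∧ a.2 ≤ s + L}))
  refine indep_of_indep_of_le_right h (measurable_iff_comap_le.1 ?_)
  refine @measurable_stackedInput Ω m (_) L b (u i) s fun t h1 h2 => ?_
  refine measurable_iff_comap_le.2 ?_
  have hk : (Sum.inl (i, t) : (Fin N × ℕ) ⊕ (Fin N × ℕ) ⊕ (Fin N × ℕ))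
      ∈ (Sum.inl '' {a : Fin N × ℕ | a.1 = i ∧ s ≤ a.2 ∧ a.2 ≤ s + L}) :=
    ⟨(i, t), ⟨rfl, h1, h2⟩, rfl⟩
  exact le_biSup (sourceSigma u w₁ w₂) hk

theorem iIndepFun_of_sources (hT : TrajectoryModel μ u w₁ w₂ σu σ₁ σ₂) {κ : Type*}
    {g : κ → (Fin N × ℕ) ⊕ (Fin N × ℕ) ⊕ (Fin N × ℕ)} (hg : Function.Injective g) {X : κ → Ω → ℝ}
    (hX : ∀ k, Measurable[sourceSigma u w₁ w₂ (g k)] (X k)) : iIndepFun X μ :=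
  (iIndepFun_iff_iIndep _ _ _).2
    (iIndep_of_iIndep_of_le (hT.indep.precomp hg) fun k => (hX k).comap_le)

theorem map_stackedInput (hT : TrajectoryModel μ u w₁ w₂ σu σ₁ σ₂) {L : ℕ}
    {b : Fin (L + 1) × Fin m → ℝ} (hb : b ⬝ᵥ b = 1) (i : Fin N) (s : ℕ) :
    μ.map (stackedInput L b (u i) s) = gaussianReal 0 (σu ^ 2) := by
  have hind : iIndepFun (fun (k : Fin (L + 1)) ω => (fun j => b (k, j)) ⬝ᵥ u i (L + s - k) ω) μ := by
    refine hT.iIndepFun_of_sources (g := fun k : Fin (L + 1) => Sum.inl (i, L + s - (k : ℕ)))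
      (X := fun k ω => (fun j => b (k, j)) ⬝ᵥ u i (L + s - k) ω) ?_ fun k => ?_
    · intro k l hkl
      simp only [Sum.inl.injEq, Prod.mk.injEq, true_and] at hkl
      ext
      omega
    · exact @measurable_dotProduct Ω (_) m _ (measurable_iff_comap_le.2 le_rfl) _
  have h := map_sum_eq_gaussianReal hind
    (fun k => measurable_dotProduct (hT.measurable_input _ _) _)
    (fun k => map_dotProduct_eq_gaussianReal (hT.measurable_input _ _) (hT.input_law _ _) _)
    Finset.univ
  have hsum : ∑ k : Fin (L + 1), (fun j => b (k, j)) ⬝ᵥ (fun j => b (k, j)) = 1 := by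
    rw [← hb, dotProduct, Fintype.sum_prod_type]
    rfl
  rw [← Finset.sum_mul, ← Real.toNNReal_sum_of_nonneg
    fun k _ => Matrix.dotProduct_self_nonneg_real _, hsum, Real.toNNReal_one, one_mul] at h
  rw [← h]
  congr 1
  ext ω
  simp [stackedInput]

/-- The residual marginal is a sum of independent forms, so proxies add. Inputs older than `L` steps
pass through `CA^L`, giving the quadratic form of `gramian` at `(CA^L)ᵀ a`; the identity summand of
`obsGramian` pays for the measurement noise. -/
theorem hasSubgaussianMGF_residual [IsProbabilityMeasure μ]
    (hT : TrajectoryModel μ u w₁ w₂ σu σ₁ σ₂) {M : LTI n m p}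
    (hM : M.StrictlyStable) {σw : ℝ≥0} (hσw : σw = max σ₁ σ₂) (L : ℕ) {a : Fin p → ℝ}
    (ha : a ⬝ᵥ a = 1) (i : Fin N) (t : ℕ) {v : ℝ≥0}
    (hv : specNorm (M.C * M.A ^ L) ^ 2 * specNorm (M.gramian σu σw)
      + σw ^ 2 * specNorm M.obsGramian ≤ v) :
    HasSubgaussianMGF (fun ω => a ⬝ᵥ M.residual L (fun t => u i t ω) (fun t => w₁ i t ω)
      (fun t => w₂ i t ω) t) v μ := by
  let b₁ : ℕ → Fin m → ℝ := fun s => (M.C * M.A ^ (t - 1 - s) * M.B)ᵀ *ᵥ a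
  let b₂ : ℕ → Fin n → ℝ := fun s => (M.C * M.A ^ (t - 1 - s))ᵀ *ᵥ a
  let X : ℕ ⊕ ℕ ⊕ Unit → Ω → ℝ := Sum.elim (fun s ω => b₁ s ⬝ᵥ u i s ω)
    (Sum.elim (fun s ω => b₂ s ⬝ᵥ w₁ i s ω) fun _ ω => a ⬝ᵥ w₂ i t ω)
  let V : ℕ ⊕ ℕ ⊕ Unit → ℝ≥0 := Sum.elim (fun s => (b₁ s ⬝ᵥ b₁ s).toNNReal * σu ^ 2)
    (Sum.elim (fun s => (b₂ s ⬝ᵥ b₂ s).toNNReal * σ₁ ^ 2) fun _ => (a ⬝ᵥ a).toNNReal * σ₂ ^ 2)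
  let g : ℕ ⊕ ℕ ⊕ Unit → (Fin N × ℕ) ⊕ (Fin N × ℕ) ⊕ (Fin N × ℕ) := Sum.elim (fun s => Sum.inl (i, s))
    (Sum.elim (fun s => Sum.inr (Sum.inl (i, s))) fun _ => Sum.inr (Sum.inr (i, t)))
  have hg : Function.Injective g := by
    rintro (s | s | s) (r | r | r) h <;> simp_all [g]
  have hind : iIndepFun X μ := by
    refine hT.iIndepFun_of_sources hg ?_
    rintro (s | s | s)
    · exact @measurable_dotProduct Ω (_) m _ (measurable_iff_comap_le.2 le_rfl) _
    · exact @measurable_dotProduct Ω (_) n _ (measurable_iff_comap_le.2 le_rfl) _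
    · exact @measurable_dotProduct Ω (_) p _ (measurable_iff_comap_le.2 le_rfl) _
  have hsub : ∀ k, HasSubgaussianMGF (X k) (V k) μ := by
    rintro (s | s | s)
    · exact HasSubgaussianMGF.of_map_eq_gaussianReal
        (measurable_dotProduct (hT.measurable_input i s) _)
        (map_dotProduct_eq_gaussianReal (hT.measurable_input i s) (hT.input_law i s) _)
    · exact (hT.process_subgaussian i s).dotProduct _
    · exact (hT.measurement_subgaussian i t).dotProduct _
  have h := HasSubgaussianMGF.sum_of_iIndepFun hind
    (s := (Finset.range (t - L)).disjSum ((Finset.range t).disjSum {()})) fun k _ => hsub k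
  have hle : ∑ k ∈ (Finset.range (t - L)).disjSum ((Finset.range t).disjSum {()}), V k ≤ v := by
    rw [← NNReal.coe_le_coe]
    refine le_trans ?_ hv
    have h0 : ∀ {k : ℕ} (x : Fin k → ℝ), ((x ⬝ᵥ x).toNNReal : ℝ) = x ⬝ᵥ x := fun x =>
      Real.coe_toNNReal _ (Matrix.dotProduct_self_nonneg_real x)
    have hσ₁ : (σ₁ : ℝ) ^ 2 ≤ (σw : ℝ) ^ 2 :=
      pow_le_pow_left₀ σ₁.2 (by rw [hσw]; exact_mod_cast le_max_left _ _) 2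
    have hσ₂ : (σ₂ : ℝ) ^ 2 ≤ (σw : ℝ) ^ 2 :=
      pow_le_pow_left₀ σ₂.2 (by rw [hσw]; exact_mod_cast le_max_right _ _) 2
    rw [Finset.sum_disjSum, Finset.sum_disjSum]
    simp only [V, Sum.elim_inl, Sum.elim_inr, Finset.sum_singleton]
    push_cast
    simp only [h0, ← Finset.sum_mul]
    refine add_le_add ?_ ?_
    · set a' := (M.C * M.A ^ L)ᵀ *ᵥ a with ha'
      have hb : ∀ s ∈ Finset.range (t - L),
          b₁ (t - L - 1 - s) = (M.A ^ s * M.B)ᵀ *ᵥ a' := fun s hs => by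
        have hs' := Finset.mem_range.1 hs
        simp only [b₁, ha', mulVec_mulVec, ← transpose_mul]
        rw [show t - 1 - (t - L - 1 - s) = L + s by omega, pow_add]
        simp only [Matrix.mul_assoc]
      have h1 := LTI.sum_le_gramian hM (σu : ℝ) (σw : ℝ) (Finset.range (t - L)) a'
      have h2 := dotProduct_mulVec_le_specNorm (M.gramian σu σw) a'
      have h3 := dotProduct_transpose_mulVec_self (M.C * M.A ^ L) a
      rw [ha, mul_one] at h3
      rw [← Finset.sum_range_reflect, Finset.sum_congr rfl fun s hs => by rw [hb s hs], mul_comm,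
        Finset.mul_sum]
      nlinarith [mul_le_mul_of_nonneg_left h3 (specNorm_nonneg (M.gramian σu σw))]
    · have hb : ∀ s ∈ Finset.range t, b₂ (t - 1 - s) = (M.C * M.A ^ s)ᵀ *ᵥ a := fun s hs => by
        have hs' := Finset.mem_range.1 hs
        simp only [b₂]
        rw [show t - 1 - (t - 1 - s) = s by omega]
      have h1 := LTI.sum_le_obsGramian hM (Finset.range t) a
      have h2 := dotProduct_mulVec_le_specNorm M.obsGramian a
      have h3 : 0 ≤ ∑ s ∈ Finset.range t, b₂ s ⬝ᵥ b₂ s :=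
        Finset.sum_nonneg fun _ _ => Matrix.dotProduct_self_nonneg_real _
      have h4 : ∑ s ∈ Finset.range t, b₂ s ⬝ᵥ b₂ s
          = ∑ s ∈ Finset.range t, ((M.C * M.A ^ s)ᵀ *ᵥ a) ⬝ᵥ ((M.C * M.A ^ s)ᵀ *ᵥ a) := by
        rw [← Finset.sum_range_reflect]
        exact Finset.sum_congr rfl fun s hs => by rw [hb s hs]
      rw [← h4] at h1
      rw [ha] at h1 h2 ⊢
      nlinarith [mul_le_mul_of_nonneg_left hσ₁ h3,
        mul_le_mul_of_nonneg_left (h1.trans h2) (sq_nonneg (σw : ℝ))]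
  refine (h.of_le hle).congr (ae_of_all _ fun ω => ?_)
  simp only [Finset.sum_disjSum, X, Sum.elim_inl, Sum.elim_inr, Finset.sum_singleton]
  rw [LTI.residual, dotProduct_add, dotProduct_add, dotProduct_sum, dotProduct_sum, add_assoc]
  simp only [b₁, b₂, mulVec_transpose, ← dotProduct_mulVec]

/-- The stacked inputs and residuals are adapted within each residue class modulo `L + 1`. -/
theorem coloredAdapted (hT : TrajectoryModel μ u w₁ w₂ σu σ₁ σ₂) (M : LTI n m p) (L T : ℕ)
    (a : Fin p → ℝ) {b : Fin (L + 1) × Fin m → ℝ} (hb : b ⬝ᵥ b = 1) :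
    ColoredAdapted μ (gaussianReal 0 (σu ^ 2))
      (fun c : Fin N × Fin T => (⟨c.2 % (L + 1), Nat.mod_lt _ L.succ_pos⟩ : Fin (L + 1)))
      (fun c => c.2) (fun c => outsideSigma u w₁ w₂ L c.1 c.2)
      (fun c ω => a ⬝ᵥ M.residual L (fun t => u c.1 t ω) (fun t => w₁ c.1 t ω)
        (fun t => w₂ c.1 t ω) (L + c.2))
      (fun c => stackedInput L b (u c.1) c.2) where
  le c := hT.outsideSigma_le L c.1 c.2
  law c := hT.map_stackedInput hb c.1 c.2
  indep c := hT.indep_outsideSigma_stackedInput b c.1 c.2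
  measurable c := measurable_stackedInput b fun _ _ _ => hT.measurable_input _ _
  adapted c :=
    @LTI.measurable_dotProduct_residual Ω (_) n m p M L _ _ _ _
      (fun s hs => measurable_outsideSigma_input (by omega))
      (fun s => measurable_outsideSigma_process) (fun s => measurable_outsideSigma_measurement) a
  past := by
    rintro ⟨i, s⟩ ⟨j, r⟩ hcol hne hle
    simp only [Fin.mk.injEq] at hcol hle
    -- Distinct times congruent modulo `L + 1` differ by at least `L + 1`, so the windows `[r, r +
    -- L]` and `[s, s + L]` are disjoint. Different trajectories need no gap.
    have hfar : j = i → (r : ℕ) + L < s := by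
      rintro rfl
      have hrs : (r : ℕ) ≠ s := fun h => hne (by rw [Fin.ext h])
      have hdvd : L + 1 ∣ (s : ℕ) - r := (Nat.modEq_iff_dvd' hle).1 hcol.symm
      have := Nat.le_of_dvd (by omega) hdvd
      omega
    constructor
    · exact @LTI.measurable_dotProduct_residual Ω (_) n m p M L _ _ _ _
        (fun t ht => measurable_outsideSigma_input (by
          rintro ⟨h1, h2, h3⟩
          have := hfar h1
          simp only at ht h2
          omega))
        (fun s => measurable_outsideSigma_process) (fun s => measurable_outsideSigma_measurement) a
    · exact @measurable_stackedInput Ω m (_) L b _ _ fun t h1 h2 =>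
        measurable_outsideSigma_input (by
          rintro ⟨h3, h4, h5⟩
          have := hfar h3
          simp only at h4 h2
          omega)

end TrajectoryModel

end Sources

/-! ### The estimation error -/

section Estimation

variable {N n m p : ℕ}

theorem dotProduct_inputMatrix {Ω : Type*} (L Tbar : ℕ) (b : Fin (L + 1) × Fin m → ℝ)
    (u : Fin N → ℕ → Ω → Fin m → ℝ) (ω : Ω) (c : Fin N × Fin (Tbar - L + 1)) :
    b ⬝ᵥ (inputMatrix L Tbar fun i t => u i t ω)ᵀ c = stackedInput L b (u c.1) c.2 ω := by
  rw [dotProduct, Fintype.sum_prod_type]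
  rfl

theorem dotProduct_mul_transpose_mulVec_eq_sum {a b c : Type*} [Fintype a] [Fintype b] [Fintype c]
    (E : Matrix a c ℝ) (U : Matrix b c ℝ) (x : a → ℝ) (y : b → ℝ) :
    x ⬝ᵥ (E * Uᵀ) *ᵥ y = ∑ j, (x ⬝ᵥ Eᵀ j) * (y ⬝ᵥ Uᵀ j) := by
  rw [← mulVec_mulVec, dotProduct_mulVec, dotProduct]
  refine Finset.sum_congr rfl fun j _ => ?_
  rw [mulVec, dotProduct_comm (Uᵀ j)]
  rfl

/-- Deterministic error bound: on nets of the unit spheres the inputs are well conditioned and the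
correlation of inputs and residuals is bounded by `R`. -/
theorem lsError_le_of_nets (M : LTI n m p) (L Tbar : ℕ) (u : Fin N → ℕ → Fin m → ℝ)
    (w₁ : Fin N → ℕ → Fin n → ℝ) (w₂ : Fin N → ℕ → Fin p → ℝ) {R ρ : ℝ} (hR : 0 ≤ R) (hρ : 0 < ρ)
    {s : Set (EuclideanSpace ℝ (Fin p))} {t : Set (EuclideanSpace ℝ (Fin (L + 1) × Fin m))}
    (hs : ∀ x : EuclideanSpace ℝ (Fin p), ‖x‖ = 1 → ∃ y ∈ s, ‖x - y‖ ≤ 1 / 16)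
    (ht : ∀ x : EuclideanSpace ℝ (Fin (L + 1) × Fin m), ‖x‖ = 1 → ∃ y ∈ t, ‖x - y‖ ≤ 1 / 16)
    (hu : ∀ y ∈ t, ∑ c, (y.ofLp ⬝ᵥ (inputMatrix L Tbar u)ᵀ c) ^ 2 ≤ (2 * ρ) ^ 2)
    (hl : ∀ y ∈ t, (ρ / 2) ^ 2 ≤ ∑ c, (y.ofLp ⬝ᵥ (inputMatrix L Tbar u)ᵀ c) ^ 2)
    (hE : ∀ x ∈ s, ∀ y ∈ t, ∑ c,
      (x.ofLp ⬝ᵥ (outputMatrix L Tbar fun i => M.residual L (u i) (w₁ i) (w₂ i))ᵀ c)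
        * (y.ofLp ⬝ᵥ (inputMatrix L Tbar u)ᵀ c) ≤ R) :
    lsError M L Tbar u w₁ w₂ ≤ 18 * R / ρ ^ 2 := by
  set U := inputMatrix L Tbar u
  set E := outputMatrix L Tbar fun i => M.residual L (u i) (w₁ i) (w₂ i)
  have hlow : ∀ x, ρ / 3 * ‖WithLp.toLp 2 x‖ ≤ ‖WithLp.toLp 2 (Uᵀ *ᵥ x)‖ := fun x => by
    refine le_trans ?_ (le_norm_transpose_mulVec_of_net U (by norm_num) (by positivity) ht hu hl x)
    refine mul_le_mul_of_nonneg_right ?_ (norm_nonneg _)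
    -- The net bound `2ρ` costs `2ρ · (16/15) / 16`; what remains of `ρ / 2` exceeds `ρ / 3`.
    have h : ρ / 2 - 2 * ρ / (1 - 1 / 16) * (1 / 16) = 11 / 30 * ρ := by ring
    linarith
  have hone : U * pinv U = 1 := mul_pinv_eq_one U fun x hx => by
    have := hlow x
    rw [hx, WithLp.toLp_zero, norm_zero] at this
    have h0 : ‖WithLp.toLp 2 x‖ = 0 :=
      le_antisymm (nonpos_of_mul_nonpos_right this (by positivity)) (norm_nonneg _)
    simpa using h0
  have herr : lsEstimate L Tbar u (fun i => M.output (u i) (w₁ i) (w₂ i)) - M.markovMatrix L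
      = E * pinv U := by
    rw [lsEstimate, LTI.outputMatrix_eq, Matrix.add_mul, Matrix.mul_assoc, hone, Matrix.mul_one,
      add_sub_cancel_left]
  have hcross := specNorm_le_of_nets (E * Uᵀ) (by norm_num) hR hs ht fun x hx y hy => by
    rw [dotProduct_mul_transpose_mulVec_eq_sum]
    exact hE x hx y hy
  rw [lsError, herr]
  refine (specNorm_mul_pinv_le E U (by positivity : 0 < ρ / 3) hlow).trans ?_
  rw [div_le_div_iff₀ (by positivity) (by positivity)]
  have h : R / (1 - 1 / 16) / (1 - 1 / 16) = 256 / 225 * R := by ring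
  -- The factor `256/225` is rounded up to `2`; with `(ρ / 3)⁻² = 9 / ρ²` this gives `18`.
  have : specNorm (E * Uᵀ) ≤ 2 * R := by linarith
  nlinarith [mul_le_mul_of_nonneg_right this (sq_nonneg ρ)]

variable {Ω : Type*} [MeasurableSpace Ω] {μ : Measure Ω} [IsProbabilityMeasure μ]
  {σu σ₁ σ₂ σw : ℝ≥0} {u : Fin N → ℕ → Ω → Fin m → ℝ} {w₁ : Fin N → ℕ → Ω → Fin n → ℝ}
  {w₂ : Fin N → ℕ → Ω → Fin p → ℝ}

/-- Union bound over the nets, whose cardinalities are powers of `1 + 2 · 16 = 33`. Positivity of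
`v` is needed because the exponential parameter is inversely proportional to `√v`. -/
theorem measure_lsError_gt_le_of_pos (hT : TrajectoryModel μ u w₁ w₂ σu σ₁ σ₂) {M : LTI n m p}
    (hM : M.StrictlyStable) (hσu : 0 < σu) (hσw : σw = max σ₁ σ₂) (hN : 0 < N) (L Tbar : ℕ)
    {v : ℝ≥0} (hv0 : 0 < v)
    (hv : specNorm (M.C * M.A ^ L) ^ 2 * specNorm (M.gramian σu σw)
      + σw ^ 2 * specNorm M.obsGramian ≤ v) {s K : ℝ} (hs : 0 ≤ s)
    (hK : K = N * ((Tbar - L + 1 : ℕ) : ℝ)) :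
    μ {ω | 18 * (s * (σu * √(8 * (L + 1 : ℕ) * v * K))) / (σu * √K) ^ 2
        < lsError M L Tbar (fun i t => u i t ω) (fun i t => w₁ i t ω) (fun i t => w₂ i t ω)}
      ≤ ENNReal.ofReal (33 ^ (p + (L + 1) * m) * (2 * Real.exp (-s))
        + 33 ^ ((L + 1) * m) * (2 * Real.exp (-(K / (4 * (L + 1 : ℕ)))))) := by
  classical
  have : Nonempty (Fin N × Fin (Tbar - L + 1)) := ⟨(⟨0, hN⟩, 0)⟩
  have hcard : (Fintype.card (Fin N × Fin (Tbar - L + 1)) : ℝ) = K := by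
    rw [hK]; simp
  have hK0 : 0 < K := by rw [← hcard]; exact_mod_cast Fintype.card_pos
  have hσ0 : (0 : ℝ) < σu := hσu
  obtain ⟨S, hS1, hS2, hS3⟩ := exists_unit_net (EuclideanSpace ℝ (Fin p)) (ε := 1 / 16) (by norm_num)
  obtain ⟨T, hT1, hT2, hT3⟩ :=
    exists_unit_net (EuclideanSpace ℝ (Fin (L + 1) × Fin m)) (ε := 1 / 16) (by norm_num)
  have h33 : (1 + 2 / (1 / 16) : ℝ) = 33 := by norm_num
  rw [h33, finrank_euclideanSpace, Fintype.card_fin] at hS3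
  rw [h33, finrank_euclideanSpace, Fintype.card_prod, Fintype.card_fin, Fintype.card_fin] at hT3
  have hunit : ∀ {k : Type} [Fintype k] (x : EuclideanSpace ℝ k), ‖x‖ = 1 →
      x.ofLp ⬝ᵥ x.ofLp = 1 := fun x hx => by
    have := norm_sq_toLp x.ofLp
    rw [← this, WithLp.toLp_ofLp, hx, one_pow]
  set R : ℝ := s * (σu * √(8 * (L + 1 : ℕ) * v * K)) with hR
  have hR0 : 0 ≤ R := by positivity
  let e : EuclideanSpace ℝ (Fin p) → Fin N × Fin (Tbar - L + 1) → Ω → ℝ := fun x c ω =>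
    x.ofLp ⬝ᵥ M.residual L (fun t => u c.1 t ω) (fun t => w₁ c.1 t ω) (fun t => w₂ c.1 t ω) (L + c.2)
  let z : EuclideanSpace ℝ (Fin (L + 1) × Fin m) → Fin N × Fin (Tbar - L + 1) → Ω → ℝ :=
    fun y c => stackedInput L y.ofLp (u c.1) c.2
  have hq : 0 < L + 1 := L.succ_pos
  let B₁ : EuclideanSpace ℝ (Fin p) × EuclideanSpace ℝ (Fin (L + 1) × Fin m) → Set Ω := fun xy =>
    {ω | R ≤ ∑ c, e xy.1 c ω * z xy.2 c ω}
  let B₂ : EuclideanSpace ℝ (Fin (L + 1) × Fin m) → Set Ω := fun y =>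
    {ω | 4 * σu ^ 2 * K ≤ ∑ c, z y c ω ^ 2} ∪ {ω | ∑ c, z y c ω ^ 2 ≤ σu ^ 2 * K / 4}
  have hB₁ : ∀ xy ∈ S ×ˢ T, μ (B₁ xy) ≤ ENNReal.ofReal (2 * Real.exp (-s)) := fun xy hxy => by
    obtain ⟨hx, hy⟩ := Finset.mem_product.1 hxy
    have := (hT.coloredAdapted M L (Tbar - L + 1) xy.1.ofLp
      (hunit _ (hT1 _ hy))).measure_sum_mul_ge_le hq hσu hv0
      (fun c => hT.hasSubgaussianMGF_residual hM hσw L (hunit _ (hS1 _ hx)) c.1 _ hv) s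
    rw [hcard] at this
    exact this
  have hB₂ : ∀ y ∈ T, μ (B₂ y) ≤ ENNReal.ofReal (2 * Real.exp (-(K / (4 * (L + 1 : ℕ))))) :=
      fun y hy => by
    -- The residual plays no role in the conditioning, so its direction is set to `0`.
    have h := hT.coloredAdapted M L (Tbar - L + 1) 0 (hunit _ (hT1 _ hy))
    have h1 := h.measure_sum_sq_ge_le hq hσu
    have h2 := h.measure_sum_sq_le_le hq hσu
    rw [hcard] at h1 h2
    refine (measure_union_le _ _).trans ((add_le_add h1 h2).trans_eq ?_)
    rw [← ENNReal.ofReal_add (Real.exp_pos _).le (Real.exp_pos _).le, two_mul]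
  have hsub : {ω | 18 * R / (σu * √K) ^ 2
        < lsError M L Tbar (fun i t => u i t ω) (fun i t => w₁ i t ω) (fun i t => w₂ i t ω)}
      ⊆ (⋃ xy ∈ S ×ˢ T, B₁ xy) ∪ ⋃ y ∈ T, B₂ y := by
    intro ω hω
    by_contra hcon
    simp only [Set.mem_union, Set.mem_iUnion, not_or, not_exists] at hcon
    obtain ⟨hc1, hc2⟩ := hcon
    have hρ2 : (σu * √K) ^ 2 = σu ^ 2 * K := by rw [mul_pow, Real.sq_sqrt hK0.le]
    rw [Set.mem_ofPred_eq] at hω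
    refine absurd hω (not_lt.2 ?_)
    refine lsError_le_of_nets M L Tbar _ _ _ hR0 (by positivity) (s := S) (t := T) hS2 hT2
      (fun y hy => ?_) (fun y hy => ?_) fun x hx y hy => ?_
    · simp only [dotProduct_inputMatrix]
      have h := hc2 y hy
      simp only [B₂, Set.mem_union, not_or, Set.mem_ofPred_eq, not_le] at h
      rw [mul_pow, hρ2]
      linarith [h.1]
    · simp only [dotProduct_inputMatrix]
      have h := hc2 y hy
      simp only [B₂, Set.mem_union, not_or, Set.mem_ofPred_eq, not_le] at h
      rw [div_pow, hρ2]
      linarith [h.2]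
    · simp only [dotProduct_inputMatrix]
      have h := hc1 (x, y) (Finset.mem_product.2 ⟨hx, hy⟩)
      simp only [B₁, Set.mem_ofPred_eq, not_le] at h
      exact h.le
  calc μ _ ≤ μ (⋃ xy ∈ S ×ˢ T, B₁ xy) + μ (⋃ y ∈ T, B₂ y) :=
        (measure_mono hsub).trans (measure_union_le _ _)
    _ ≤ ∑ xy ∈ S ×ˢ T, ENNReal.ofReal (2 * Real.exp (-s))
        + ∑ y ∈ T, ENNReal.ofReal (2 * Real.exp (-(K / (4 * (L + 1 : ℕ))))) :=
        add_le_add ((measure_biUnion_finset_le _ _).trans (Finset.sum_le_sum hB₁))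
          ((measure_biUnion_finset_le _ _).trans (Finset.sum_le_sum hB₂))
    _ = ENNReal.ofReal ((S.card * T.card) * (2 * Real.exp (-s))
        + T.card * (2 * Real.exp (-(K / (4 * (L + 1 : ℕ)))))) := by
        rw [ENNReal.ofReal_add (by positivity) (by positivity), ← Nat.cast_mul,
          ENNReal.ofReal_mul (p := ((S.card * T.card : ℕ) : ℝ)) (by positivity),
          ENNReal.ofReal_mul (p := (T.card : ℝ)) (by positivity), Finset.sum_const,
          Finset.sum_const, Finset.card_product, nsmul_eq_mul, nsmul_eq_mul,
          ENNReal.ofReal_natCast, ENNReal.ofReal_natCast]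
    _ ≤ _ := by
        rw [pow_add]
        gcongr

end Estimation

/-! ### From the tail parameter to the confidence level `δ`. -/

section FiniteSample

theorem sqrt_add_le_add_sqrt {x y : ℝ} (hx : 0 ≤ x) (hy : 0 ≤ y) : √(x + y) ≤ √x + √y := by
  refine Real.sqrt_le_iff.2 ⟨by positivity, ?_⟩
  rw [add_sq, Real.sq_sqrt hx, Real.sq_sqrt hy]
  have : 0 ≤ 2 * √x * √y := by positivity
  linarith

/-- `33 ≤ e⁴` absorbs the net. Since `δ < 1/e`, two of the three logarithms absorb the factor `4 ≤
e²`, and the third produces `δ`. -/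
theorem pow_mul_exp_neg_le {δ : ℝ} (hδ : 0 < δ) (hδe : δ < 1 / Real.exp 1) {k : ℕ} {S : ℝ}
    (h : 4 * k + 3 * Real.log (1 / δ) ≤ S) : 33 ^ k * (2 * Real.exp (-S)) ≤ δ / 2 := by
  have he := Real.exp_one_gt_d9
  have hl : 1 ≤ Real.log (1 / δ) := by
    rw [Real.le_log_iff_exp_le (by positivity), le_one_div (Real.exp_pos _) hδ]
    exact hδe.le
  have h33 : (33 : ℝ) ^ k ≤ Real.exp (4 * k) := by
    rw [mul_comm, Real.exp_nat_mul]
    refine pow_le_pow_left₀ (by norm_num) ?_ k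
    rw [show (4 : ℝ) = (4 : ℕ) * 1 by norm_num, Real.exp_nat_mul]
    calc (33 : ℝ) ≤ 2.7 ^ 4 := by norm_num
      _ ≤ _ := pow_le_pow_left₀ (by norm_num) (by linarith) 4
  have h4 : 4 ≤ Real.exp (2 * Real.log (1 / δ)) := by
    have h2 : (4 : ℝ) ≤ Real.exp 2 := by
      rw [show (2 : ℝ) = (2 : ℕ) * 1 by norm_num, Real.exp_nat_mul]
      nlinarith
    exact h2.trans (Real.exp_le_exp.2 (by linarith))
  have hδ' : Real.exp (-Real.log (1 / δ)) = δ := by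
    rw [one_div, Real.log_inv, neg_neg, Real.exp_log hδ]
  calc 33 ^ k * (2 * Real.exp (-S))
      ≤ Real.exp (4 * k) * (2 * Real.exp (-S)) := by gcongr
    _ = 4 * Real.exp (4 * k - S) / 2 := by rw [sub_eq_add_neg, Real.exp_add]; ring
    _ ≤ Real.exp (2 * Real.log (1 / δ)) * Real.exp (4 * k - S) / 2 := by gcongr
    _ ≤ Real.exp (-Real.log (1 / δ)) / 2 := by
      rw [← Real.exp_add]
      gcongr
      linarith
    _ = δ / 2 := by rw [hδ']

/-- Continuity from below. It covers the degenerate case where the proxy `V` vanishes. -/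
theorem measure_gt_le_of_forall_pos {Ω : Type*} [MeasurableSpace Ω] {μ : Measure Ω} {f : Ω → ℝ}
    {r : ℝ} {d : ENNReal} (h : ∀ x > 0, μ {ω | r + x < f ω} ≤ d) : μ {ω | r < f ω} ≤ d := by
  have hU : {ω | r < f ω} = ⋃ k : ℕ, {ω | r + 1 / ((k : ℝ) + 1) < f ω} := by
    ext ω
    simp only [Set.mem_ofPred_eq, Set.mem_iUnion]
    constructor
    · intro hω
      obtain ⟨k, hk⟩ := exists_nat_one_div_lt (sub_pos.2 hω)
      exact ⟨k, by linarith⟩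
    · rintro ⟨k, hk⟩
      have : (0 : ℝ) < 1 / ((k : ℝ) + 1) := by positivity
      linarith
  have hmono : Monotone fun k : ℕ => {ω | r + 1 / ((k : ℝ) + 1) < f ω} := fun k l hkl ω hω => by
    have := Nat.one_div_le_one_div (α := ℝ) hkl
    rw [Set.mem_ofPred_eq] at hω ⊢
    linarith
  rw [hU, hmono.measure_iUnion]
  exact iSup_le fun k => h _ (by positivity)

variable {N n m p : ℕ} {Ω : Type*} [MeasurableSpace Ω] {μ : Measure Ω} [IsProbabilityMeasure μ]
  {σu σ₁ σ₂ σw : ℝ≥0} {u : Fin N → ℕ → Ω → Fin m → ℝ} {w₁ : Fin N → ℕ → Ω → Fin n → ℝ}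
  {w₂ : Fin N → ℕ → Ω → Fin p → ℝ}

/-- High-probability error bound with the joint variance proxy of the residuals. -/
theorem measure_lsError_gt_le (hT : TrajectoryModel μ u w₁ w₂ σu σ₁ σ₂) {M : LTI n m p}
    (hM : M.StrictlyStable) (hσu : 0 < σu) (hσw : σw = max σ₁ σ₂) (hN : 0 < N) {L Tbar : ℕ}
    (hL : 1 ≤ L) {δ K : ℝ} (hδ : 0 < δ) (hδe : δ < 1 / Real.exp 1)
    (hK : K = N * ((Tbar - L + 1 : ℕ) : ℝ))
    (hKL : 64 * (L * (m * L + Real.log (1 / δ))) ≤ K) :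
    μ {ω | 576 * (√L * (p + m * L + Real.log (1 / δ)) / (σu * √K))
          * √(specNorm (M.C * M.A ^ L) ^ 2 * specNorm (M.gramian σu σw)
            + σw ^ 2 * specNorm M.obsGramian)
        < lsError M L Tbar (fun i t => u i t ω) (fun i t => w₁ i t ω) (fun i t => w₂ i t ω)}
      ≤ ENNReal.ofReal δ := by
  set V : ℝ := specNorm (M.C * M.A ^ L) ^ 2 * specNorm (M.gramian σu σw)
    + σw ^ 2 * specNorm M.obsGramian with hV
  have hV0 : 0 ≤ V := by
    have := specNorm_nonneg (M.gramian σu σw)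
    have := specNorm_nonneg M.obsGramian
    positivity
  have hl : 1 ≤ Real.log (1 / δ) := by
    rw [Real.le_log_iff_exp_le (by positivity), le_one_div (Real.exp_pos _) hδ]
    exact hδe.le
  set l := Real.log (1 / δ)
  have hL' : (1 : ℝ) ≤ L := by exact_mod_cast hL
  have hσ0 : (0 : ℝ) < σu := hσu
  have hN' : (0 : ℝ) < N := by exact_mod_cast hN
  have hK0 : 0 < K := by rw [hK]; positivity
  -- Since `(L + 1) m ≤ 2 m L`, the factor `8` dominates `4 (p + (L + 1) m) + 3 l`.
  set s : ℝ := 8 * (p + m * L + l) with hs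
  have hs0 : 0 < s := by positivity
  set a : ℝ := 576 * (√L * (p + m * L + l) / (σu * √K)) with ha
  have ha0 : 0 < a := by positivity
  have hprob : 33 ^ (p + (L + 1) * m) * (2 * Real.exp (-s))
      + 33 ^ ((L + 1) * m) * (2 * Real.exp (-(K / (4 * (L + 1 : ℕ))))) ≤ δ := by
    have hm : (m : ℝ) ≤ m * L := le_mul_of_one_le_right (Nat.cast_nonneg _) hL'
    have h1 : 33 ^ (p + (L + 1) * m) * (2 * Real.exp (-s)) ≤ δ / 2 := by
      refine pow_mul_exp_neg_le hδ hδe ?_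
      change 4 * _ + 3 * l ≤ _
      push_cast
      rw [hs]
      nlinarith
    have h2 : 33 ^ ((L + 1) * m) * (2 * Real.exp (-(K / (4 * (L + 1 : ℕ))))) ≤ δ / 2 := by
      refine pow_mul_exp_neg_le hδ hδe ?_
      change 4 * _ + 3 * l ≤ _
      rw [le_div_iff₀ (by positivity)]
      push_cast
      refine le_trans ?_ hKL
      calc (4 * ((L + 1) * m) + 3 * l) * (4 * ((L : ℝ) + 1))
          ≤ (8 * (m * L + l)) * (8 * L) := by
            refine mul_le_mul ?_ ?_ (by positivity) (by positivity) <;> nlinarith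
        _ = 64 * (L * (m * L + l)) := by ring
    linarith
  refine measure_gt_le_of_forall_pos fun x hx => ?_
  have hx' : 0 < x / a := by positivity
  -- The perturbation makes the proxy positive and raises `a √V` by at most `x`.
  let v : ℝ≥0 := ⟨V + (x / a) ^ 2, by positivity⟩
  have hv0 : 0 < v := by
    rw [← NNReal.coe_pos]
    change 0 < V + (x / a) ^ 2
    positivity
  refine le_trans (measure_mono fun ω hω => ?_)
    ((measure_lsError_gt_le_of_pos hT hM hσu hσw hN L Tbar hv0
      (le_add_of_nonneg_right (sq_nonneg (x / a))) hs0.le hK).trans (ENNReal.ofReal_le_ofReal hprob))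
  rw [Set.mem_ofPred_eq] at hω ⊢
  refine lt_of_le_of_lt ?_ hω
  have hvV : √(v : ℝ) ≤ √V + x / a :=
    (sqrt_add_le_add_sqrt (by positivity) (by positivity)).trans (by rw [Real.sqrt_sq hx'.le])
  have hsq : √(8 * (L + 1 : ℕ) * v * K) ≤ 4 * √L * √v * √K := by
    have h16 : (4 : ℝ) = √16 := by
      rw [show (16 : ℝ) = 4 ^ 2 by norm_num, Real.sqrt_sq (by norm_num)]
    rw [h16, ← Real.sqrt_mul (by norm_num), ← Real.sqrt_mul (by positivity),
      ← Real.sqrt_mul (by positivity)]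
    refine Real.sqrt_le_sqrt ?_
    have : (0 : ℝ) ≤ v := v.2
    push_cast
    refine mul_le_mul_of_nonneg_right (mul_le_mul_of_nonneg_right ?_ this) hK0.le
    linarith
  calc 18 * (s * (σu * √(8 * (L + 1 : ℕ) * v * K))) / (σu * √K) ^ 2
      ≤ 18 * (s * (σu * (4 * √L * √v * √K))) / (σu * √K) ^ 2 := by gcongr
    -- `576 = 18 · 8 · 4`: the deterministic bound, the choice of `s`, and `√(8 (L + 1)) ≤ 4 √L`.
    _ = a * √v := by
      rw [ha, hs]
      field_simp
      ring
    _ ≤ a * (√V + x / a) := by gcongr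
    _ = a * √V + x := by field_simp

theorem one_sub_le_measure_of_gt_le {f : Ω → ℝ} {r R δ : ℝ} (hrR : r ≤ R)
    (h : μ {ω | r < f ω} ≤ ENNReal.ofReal δ) (hδ : 0 ≤ δ) :
    ENNReal.ofReal (1 - δ) ≤ μ {ω | f ω ≤ R} := by
  have h1 : (1 : ENNReal) ≤ μ {ω | f ω ≤ R} + ENNReal.ofReal δ := by
    rw [← measure_univ (μ := μ)]
    refine le_trans (measure_mono fun ω _ => ?_) ((measure_union_le _ _).trans (add_le_add_right h _))
    rcases le_or_gt (f ω) r with h | h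
    · exact Or.inl (h.trans hrR)
    · exact Or.inr h
  rw [ENNReal.ofReal_sub _ hδ, ENNReal.ofReal_one]
  exact tsub_le_iff_right.2 h1

end FiniteSample

/-! ### The finite-sample theorem. -/

theorem theorem1 :
    ∃ c : ℝ, 0 < c ∧
      ∀ {Ω : Type*} [MeasurableSpace Ω] (μ : Measure Ω) [IsProbabilityMeasure μ]
        (n m p N L Tbar : ℕ) (M : LTI n m p) (σu σ₁ σ₂ σw : ℝ≥0)
        (u : Fin N → ℕ → Ω → Fin m → ℝ) (w₁ : Fin N → ℕ → Ω → Fin n → ℝ)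
        (w₂ : Fin N → ℕ → Ω → Fin p → ℝ) (δ Tf : ℝ),
        M.StrictlyStable → 0 < σu → σw = max σ₁ σ₂ →
        1 ≤ L → L ≤ Tbar → Tf = (Tbar : ℝ) - L + 1 →
        TrajectoryModel μ u w₁ w₂ σu σ₁ σ₂ →
        0 < δ → δ < 1 / Real.exp 1 →
        -- sample size at which the pooled input matrix is well conditioned
        N * Tf ≥ c * (L * (m * L + Real.log (L / δ))) →
        -- sample complexity for accuracy `ε`
        (∀ ε : ℝ, 0 < ε →
          N * Tf ≥ c * (L / (ε ^ 2 * σu ^ 2) * (p + (m + n) * L + Real.log (N * Tbar / δ)) ^ 2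
            * (specNorm (M.C * M.A ^ L) ^ 2 * specNorm (M.gramian σu σw)
              + σw ^ 2 * specNorm M.obsGramian)) →
          μ {ω | lsError M L Tbar (fun i t => u i t ω) (fun i t => w₁ i t ω)
            (fun i t => w₂ i t ω) ≤ ε} ≥ ENNReal.ofReal (1 - δ)) ∧
        -- rate
        μ {ω | lsError M L Tbar (fun i t => u i t ω) (fun i t => w₁ i t ω)
            (fun i t => w₂ i t ω)
          ≤ c * (√L * (p + (m + n) * L + Real.log (N * Tbar / δ)) / (σu * √(N * Tf))
            * (specNorm (M.C * M.A ^ L) * √(specNorm (M.gramian σu σw))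
              + σw * √(specNorm M.obsGramian)))} ≥ ENNReal.ofReal (1 - δ) := by
  -- The rate needs only `576` and the conditioning `64`; solving the rate for the sample size
  -- squares `576`.
  refine ⟨576 ^ 2, by norm_num, ?_⟩
  intro Ω _ μ _ n m p N L Tbar M σu σ₁ σ₂ σw u w₁ w₂ δ Tf hM hσu hσw hL hLT hTf hT hδ hδe hsample
  have hL' : (1 : ℝ) ≤ L := by exact_mod_cast hL
  have hσ0 : (0 : ℝ) < σu := hσu
  have hl : 1 ≤ Real.log (1 / δ) := by
    rw [Real.le_log_iff_exp_le (by positivity), le_one_div (Real.exp_pos _) hδ]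
    exact hδe.le
  have hlL : Real.log (1 / δ) ≤ Real.log (L / δ) :=
    Real.log_le_log (by positivity) (by gcongr)
  have hKL : 64 * (L * (m * L + Real.log (1 / δ))) ≤ N * Tf := by
    refine le_trans ?_ hsample
    have : L * (m * L + Real.log (1 / δ)) ≤ L * (m * L + Real.log (L / δ)) := by gcongr
    have h0 : 0 ≤ L * (m * L + Real.log (1 / δ)) := by positivity
    linarith
  have hN : 0 < N := by
    refine Nat.pos_of_ne_zero fun h => ?_
    have h0 : 0 < 64 * (L * (m * L + Real.log (1 / δ))) := by positivity
    rw [h, Nat.cast_zero, zero_mul] at hKL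
    linarith
  have hK : N * Tf = N * ((Tbar - L + 1 : ℕ) : ℝ) := by
    rw [hTf]
    push_cast [Nat.cast_sub hLT]
    ring
  have hK0 : 0 < N * Tf := by
    rw [hK]
    have : (0 : ℝ) < N := by exact_mod_cast hN
    positivity
  have hlT : Real.log (1 / δ) ≤ Real.log (N * Tbar / δ) := by
    refine Real.log_le_log (by positivity) ?_
    gcongr
    have h1 : (1 : ℝ) ≤ N := by exact_mod_cast hN
    have h2 : (1 : ℝ) ≤ Tbar := by exact_mod_cast hL.trans hLT
    nlinarith
  -- The bound already obtained is sharper, with `m L` and `log (1 / δ)`; the stated quantities only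
  -- enlarge it.
  have hP : p + m * L + Real.log (1 / δ) ≤ p + (m + n) * L + Real.log (N * Tbar / δ) := by
    have : (0 : ℝ) ≤ n * L := by positivity
    linarith
  have hP0 : 0 < p + m * L + Real.log (1 / δ) := by positivity
  have hG := specNorm_nonneg (M.gramian σu σw)
  have hO := specNorm_nonneg M.obsGramian
  have hCA := specNorm_nonneg (M.C * M.A ^ L)
  have hbad := measure_lsError_gt_le hT hM hσu hσw hN hL hδ hδe hK hKL
  set P := p + (m + n) * L + Real.log (N * Tbar / δ)
  set K := N * Tf
  set V := specNorm (M.C * M.A ^ L) ^ 2 * specNorm (M.gramian σu σw)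
    + σw ^ 2 * specNorm M.obsGramian with hV
  have hV0 : 0 ≤ V := by positivity
  have hbound : 576 * (√L * (p + m * L + Real.log (1 / δ)) / (σu * √K)) * √V
      ≤ 576 * (√L * P / (σu * √K)) * √V := by gcongr
  refine ⟨fun ε hε hcomplex => ?_, ?_⟩
  · refine one_sub_le_measure_of_gt_le (hbound.trans ?_) hbad hδ.le
    have h1 : 576 ^ 2 * (L * P ^ 2 * V) ≤ ε ^ 2 * σu ^ 2 * K := by
      have := mul_le_mul_of_nonneg_left hcomplex (by positivity : 0 ≤ ε ^ 2 * (σu : ℝ) ^ 2)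
      refine le_trans (le_of_eq ?_) this
      field_simp
    have h2 : 576 * √L * P * √V ≤ ε * σu * √K := by
      refine le_of_sq_le_sq ?_ (by positivity)
      have e1 : (576 * √L * P * √V) ^ 2 = 576 ^ 2 * (√L ^ 2 * P ^ 2 * √V ^ 2) := by ring
      have e2 : (ε * σu * √K) ^ 2 = ε ^ 2 * σu ^ 2 * √K ^ 2 := by ring
      rw [e1, e2, Real.sq_sqrt hV0, Real.sq_sqrt hK0.le, Real.sq_sqrt (by positivity)]
      exact h1
    calc 576 * (√L * P / (σu * √K)) * √V = 576 * √L * P * √V / (σu * √K) := by ring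
      _ ≤ ε := by rw [div_le_iff₀ (by positivity)]; linarith
  · refine one_sub_le_measure_of_gt_le (hbound.trans ?_) hbad hδ.le
    have h1 : √V ≤ specNorm (M.C * M.A ^ L) * √(specNorm (M.gramian σu σw))
        + σw * √(specNorm M.obsGramian) := by
      refine (sqrt_add_le_add_sqrt (by positivity) (by positivity)).trans_eq ?_
      rw [Real.sqrt_mul (sq_nonneg _), Real.sqrt_mul (sq_nonneg _), Real.sqrt_sq hCA,
        Real.sqrt_sq σw.coe_nonneg]
    have h2 : 0 ≤ √L * P / (σu * √K) := by
      have := hP0.le.trans hP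
      positivity
    rw [mul_assoc]
    refine mul_le_mul (by norm_num) (mul_le_mul_of_nonneg_left h1 h2) (by positivity) (by norm_num)
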